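/- Let $n\ge 0$, let $\mathbf v=(v_1,\dots,v_n)\in\mathbb Z_{\ge0}^n$, put $V=\sum_a v_a$, and let $\operatorname{Seq}(\mathbf v)$ be the set of words $\mathbf i=(i_1,\dots,i_V)$ in $\{1,\dots,n\}$ in which each letter $a$ occurs $v_a$ times. Write $s_k\mathbf i$ for $\mathbf i$ with its $k$th and $(k+1)$st letters exchanged. The letter $n$ is called red, the other letters black. Let $\tilde T_{\mathbf v}$ be the KLRW algebra over $\mathbb C$ of Stendhal diagrams whose strands carry labels with multiplicities $\mathbf v$ (red strands are labelled $n$, may carry dots, and never cross each other). That is, $\tilde T_{\mathbf v}$ is the unital $\mathbb C$-algebra generated by $e(\mathbf i)$ ($\mathbf i\in\operatorname{Seq}(\mathbf v)$), dots $y_k$ ($1\le k\le V$) and crossings $\psi_k$ ($1\le k<V$), where a product $ab$ is $a$ stacked on top of $b$, subject to: * $e(\mathbf i)e(\mathbf j)=\delta_{\mathbf i\mathbf j}e(\mathbf i)$, $\sum_{\mathbf i}e(\mathbf i)=1$, $y_ke(\mathbf i)=e(\mathbf i)y_k$, $\psi_ke(\mathbf i)=e(s_k\mathbf i)\psi_k$,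 $y_ky_l=y_ly_k$, $\psi_ky_l=y_l\psi_k$ for $l\ne k,k+1$, $\psi_k\psi_l=\psi_l\psi_k$ for $|k-l|>1$; * $\psi_ke(\mathbf i)=0$ if $i_k=i_{k+1}=n$; * $y_k\psi_ke(\mathbf i)=\psi_ky_{k+1}e(\mathbf i)$ and $y_{k+1}\psi_ke(\mathbf i)=\psi_ky_ke(\mathbf i)$ if $i_k\neq i_{k+1}$; $(y_k\psi_k-\psi_ky_{k+1})e(\mathbf i)=e(\mathbf i)=(\psi_ky_k-y_{k+1}\psi_k)e(\mathbf i)$ if $i_k=i_{k+1}<n$; * $\psi_k^2e(\mathbf i)$ equals $0$ if $i_k=i_{k+1}$, $(y_{k+1}-y_k)e(\mathbf i)$ if $i_k=i_{k+1}-1$, $(y_k-y_{k+1})e(\mathbf i)$ if $i_k=i_{k+1}+1$, and $e(\mathbf i)$ otherwise; * $(\psi_k\psi_{k+1}\psi_k-\psi_{k+1}\psi_k\psi_{k+1})e(\mathbf i)$ equals $e(\mathbf i)$ if $i_k=i_{k+2}=i_{k+1}+1<n$, $-e(\mathbf i)$ if $i_k=i_{k+2}=i_{k+1}-1$, and $0$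 if neither $i_k=i_{k+2}=i_{k+1}+1$ nor $i_k=i_{k+2}=i_{k+1}-1$. The algebra $\tilde T_{\mathbf v}$ acts on $\mathcal P=\bigoplus_{\mathbf i\in\operatorname{Seq}(\mathbf v)}\mathbb C[Y_1,\dots,Y_V]e(\mathbf i)$: $e(\mathbf i)$ acts by projection to the summand of $\mathbf i$, $y_k$ by multiplication by $Y_k$, and $\psi_k$ sends $fe(\mathbf i)$ to $g\,e(s_k\mathbf i)$, where, with $f^{s_k}$ denoting $f$ with $Y_k,Y_{k+1}$ exchanged, $g=\frac{f^{s_k}-f}{Y_{k+1}-Y_k}$ if $i_k=i_{k+1}<n$, $g=0$ if $i_k=i_{k+1}=n$, $g=(Y_k-Y_{k+1})f^{s_k}$ if $i_k+1=i_{k+1}$, and $g=f^{s_k}$ otherwise. Regard the dual of $\mathcal P$ as a left $\tilde T_{\mathbf v}$-module through the anti-automorphism fixing all the generators $e(\mathbf i),y_k,\psi_k$. Let $\mathrm{ev}_{\mathbf i}\in\mathcal P^*$ send $fe(\mathbf i)$ to $f(0)$ and $fe(\mathbf j)$ to $0$ for $\mathbf j\ne\mathbf i$, and let $N'(\mathbf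 i)=\tilde T_{\mathbf v}\,\mathrm{ev}_{\mathbf i}$. **Theorem.** For each $\mathbf i\in\operatorname{Seq}(\mathbf v)$ the module $N'(\mathbf i)$ has exactly one maximal proper submodule; let $N(\mathbf i)$, the canonical module, be the corresponding unique simple quotient of $N'(\mathbf i)$. For $\mathbf i,\mathbf j\in\operatorname{Seq}(\mathbf v)$, we have $N(\mathbf i)\cong N(\mathbf j)$ as $\tilde T_{\mathbf v}$-modules if and only if $\mathbf i$ and $\mathbf j$ are related by a finite (possibly empty) chain of the following moves on consecutive letters and their inverses: 1. $(\dots,r,s,\dots)\to(\dots,s,r,\dots)$ with $r\ne s\pm1$; 2. $(\dots,r,r-1,r,\dots)\to(\dots,r,r,r-1,\dots)$ with $1<r<n$; 3. $(\dots,r,r+1,r,\dots)\to(\dots,r+1,r,r,\dots)$ with $1\le r<n$. -/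

import Mathlib

/-! # KLRW algebras of type A, their polynomial representation, and canonical modules

The label set `[1, n]` is modelled by `Fin n`, the element `a : Fin n` standing for the label
`a + 1`.  The last label (`a + 1 = n`) is the red one, all other labels are black. -/

namespace KLRW

open MvPolynomial

noncomputable section

/-- Total number of strands for the dimension vector `v`. -/
abbrev numStrands {n : ℕ} (v : Fin n → ℕ) : ℕ := ∑ a, v a

/-- `Seq(v)`: words in the labels in which the label `a` occurs exactly `v a` times. -/
abbrev Seq {n : ℕ} (v : Fin n → ℕ) : Type :=
  {w : Fin (numStrands v) → Fin n // ∀ a, (Finset.univ.filter fun k => w k = a).card = v a}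

/-- Positions of crossings: `k` stands for the crossing of the strands `k` and `k + 1`. -/
abbrev Pos (V : ℕ) : Type := {k : ℕ // k + 1 < V}

/-- The left strand of a crossing. -/
def Pos.lo {V : ℕ} (k : Pos V) : Fin V := ⟨k.1, Nat.lt_of_succ_lt k.2⟩

/-- The right strand of a crossing. -/
def Pos.hi {V : ℕ} (k : Pos V) : Fin V := ⟨k.1 + 1, k.2⟩

theorem Pos.lo_ne_hi {V : ℕ} (k : Pos V) : k.lo ≠ k.hi := by
  simp [Pos.lo, Pos.hi, Fin.ext_iff]

theorem Pos.hi_ne_lo {V : ℕ} (k : Pos V) : k.hi ≠ k.lo := k.lo_ne_hi.symm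

/-- The transposition `s_k = (k, k+1)`. -/
abbrev Pos.s {V : ℕ} (k : Pos V) : Equiv.Perm (Fin V) := Equiv.swap k.lo k.hi

/-- The label `a` is red. -/
def IsRed {n : ℕ} (a : Fin n) : Prop := (a : ℕ) + 1 = n

instance {n : ℕ} (a : Fin n) : Decidable (IsRed a) := inferInstanceAs (Decidable (_ = _))

/-- `b = a + 1` as labels. -/
def IsSucc {n : ℕ} (a b : Fin n) : Prop := (a : ℕ) + 1 = b

instance {n : ℕ} (a b : Fin n) : Decidable (IsSucc a b) := inferInstanceAs (Decidable (_ = _))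

section
variable {n : ℕ} {v : Fin n → ℕ}

/-- The word with its `k`th and `k+1`st letters exchanged. -/
def Seq.swap (k : Pos (numStrands v)) (i : Seq v) : Seq v :=
  ⟨fun l => i.1 (k.s l), fun a => by
    rw [← i.2 a]
    exact Finset.card_equiv k.s (fun l => by simp)⟩

/-- The letter of a word in position `l`. -/
abbrev Seq.letter (i : Seq v) (l : Fin (numStrands v)) : Fin n := i.1 l

@[simp] theorem Seq.swap_letter (k : Pos (numStrands v)) (i : Seq v) (l : Fin (numStrands v)) :
    (Seq.swap k i).1 l = i.1 (k.s l) := rfl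

@[simp] theorem Seq.swap_swap (k : Pos (numStrands v)) (i : Seq v) :
    Seq.swap k (Seq.swap k i) = i := by
  apply Subtype.ext; funext l; simp

theorem Seq.swap_eq_self (k : Pos (numStrands v)) (i : Seq v) (h : i.1 k.lo = i.1 k.hi) :
    Seq.swap k i = i := by
  apply Subtype.ext; funext l
  simp only [Seq.swap_letter, Equiv.swap_apply_def]
  split_ifs with h1 h2
  · rw [h1, h]
  · rw [h2, h]
  · rfl

end

/-! ## The algebra -/

/-- Generators of the KLRW algebra: the straight-line diagrams `e(i)`, a dot on the `k`th strand
(summed over all words) and a crossing of the strands `k`, `k+1` (summed over all words whose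
`k`th and `k+1`st letters are not both red). -/
inductive Gen {n : ℕ} (v : Fin n → ℕ) : Type
  | e (i : Seq v) : Gen v
  | y (k : Fin (numStrands v)) : Gen v
  | psi (k : Pos (numStrands v)) : Gen v

section
variable {n : ℕ} (v : Fin n → ℕ)

/-- The free algebra on the generators. -/
abbrev Free : Type := FreeAlgebra ℂ (Gen v)

variable {v}

/-- The generator `e(i)` in the free algebra. -/
abbrev fe (i : Seq v) : Free v := FreeAlgebra.ι ℂ (Gen.e i)

/-- The generator `y_k` in the free algebra. -/
abbrev fy (k : Fin (numStrands v)) : Free v := FreeAlgebra.ι ℂ (Gen.y k)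

/-- The generator `ψ_k` in the free algebra. -/
abbrev fpsi (k : Pos (numStrands v)) : Free v := FreeAlgebra.ι ℂ (Gen.psi k)

/-- The defining relations.  Products are read as vertical composition, `a * b` being `a` stacked
on top of `b`. -/
inductive Rel : Free v → Free v → Prop
  -- vertical composition of diagrams whose end words do not match is zero
  | e_mul_self (i : Seq v) : Rel (fe i * fe i) (fe i)
  | e_mul_ne (i j : Seq v) (h : i ≠ j) : Rel (fe i * fe j) 0
  | sum_e : Rel (∑ i, fe i) 1
  | y_e (k) (i : Seq v) : Rel (fy k * fe i) (fe i * fy k)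
  | psi_e (k) (i : Seq v) : Rel (fpsi k * fe i) (fe (Seq.swap k i) * fpsi k)
  -- isotopies exchanging the heights of distant dots and crossings
  | y_y (k l : Fin (numStrands v)) : Rel (fy k * fy l) (fy l * fy k)
  | psi_y (k : Pos (numStrands v)) (l) (h1 : l ≠ k.lo) (h2 : l ≠ k.hi) :
      Rel (fpsi k * fy l) (fy l * fpsi k)
  | psi_psi (k l : Pos (numStrands v)) (h : k.1 + 1 < l.1) :
      Rel (fpsi k * fpsi l) (fpsi l * fpsi k)
  -- red strands never cross
  | red (k : Pos (numStrands v)) (i : Seq v) (h1 : IsRed (i.letter k.lo))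
      (h2 : IsRed (i.letter k.hi)) : Rel (fpsi k * fe i) 0
  -- dots slide through crossings of strands with different labels
  | slide_lo (k : Pos (numStrands v)) (i : Seq v) (h : i.letter k.lo ≠ i.letter k.hi) :
      Rel (fy k.lo * fpsi k * fe i) (fpsi k * fy k.hi * fe i)
  | slide_hi (k : Pos (numStrands v)) (i : Seq v) (h : i.letter k.lo ≠ i.letter k.hi) :
      Rel (fy k.hi * fpsi k * fe i) (fpsi k * fy k.lo * fe i)
  -- nilHecke relations
  | nil_lo (k : Pos (numStrands v)) (i : Seq v) (h : i.letter k.lo = i.letter k.hi)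
      (hr : ¬ IsRed (i.letter k.lo)) :
      Rel ((fy k.lo * fpsi k - fpsi k * fy k.hi) * fe i) (fe i)
  | nil_hi (k : Pos (numStrands v)) (i : Seq v) (h : i.letter k.lo = i.letter k.hi)
      (hr : ¬ IsRed (i.letter k.lo)) :
      Rel ((fpsi k * fy k.lo - fy k.hi * fpsi k) * fe i) (fe i)
  -- bigon relations
  | bigon_eq (k : Pos (numStrands v)) (i : Seq v) (h : i.letter k.lo = i.letter k.hi) :
      Rel (fpsi k * fpsi k * fe i) 0
  | bigon_far (k : Pos (numStrands v)) (i : Seq v) (h : i.letter k.lo ≠ i.letter k.hi)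
      (h1 : ¬ IsSucc (i.letter k.lo) (i.letter k.hi))
      (h2 : ¬ IsSucc (i.letter k.hi) (i.letter k.lo)) :
      Rel (fpsi k * fpsi k * fe i) (fe i)
  | bigon_up (k : Pos (numStrands v)) (i : Seq v)
      (h : IsSucc (i.letter k.lo) (i.letter k.hi)) :
      Rel (fpsi k * fpsi k * fe i) ((fy k.hi - fy k.lo) * fe i)
  | bigon_down (k : Pos (numStrands v)) (i : Seq v)
      (h : IsSucc (i.letter k.hi) (i.letter k.lo)) :
      Rel (fpsi k * fpsi k * fe i) ((fy k.lo - fy k.hi) * fe i)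
  -- triple point relations for the strands `k`, `k+1`, `k+2`, where `l = k + 1`
  | triple_down (k l : Pos (numStrands v)) (hkl : l.1 = k.1 + 1) (i : Seq v)
      (h : i.letter k.lo = i.letter l.hi) (hr : ¬ IsRed (i.letter k.lo))
      (h1 : IsSucc (i.letter k.hi) (i.letter k.lo)) :
      Rel ((fpsi k * fpsi l * fpsi k - fpsi l * fpsi k * fpsi l) * fe i) (fe i)
  | triple_up (k l : Pos (numStrands v)) (hkl : l.1 = k.1 + 1) (i : Seq v)
      (h : i.letter k.lo = i.letter l.hi)
      (h1 : IsSucc (i.letter k.lo) (i.letter k.hi)) :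
      Rel ((fpsi k * fpsi l * fpsi k - fpsi l * fpsi k * fpsi l) * fe i) (-fe i)
  | triple_other (k l : Pos (numStrands v)) (hkl : l.1 = k.1 + 1) (i : Seq v)
      (h : ¬ (i.letter k.lo = i.letter l.hi ∧ (IsSucc (i.letter k.hi) (i.letter k.lo) ∨
        IsSucc (i.letter k.lo) (i.letter k.hi)))) :
      Rel ((fpsi k * fpsi l * fpsi k - fpsi l * fpsi k * fpsi l) * fe i) 0

variable (v) in
/-- The KLRW algebra `T̃_v`. -/
def Alg : Type := RingQuot (Rel (v := v))

instance : Ring (Alg v) := inferInstanceAs (Ring (RingQuot (Rel (v := v))))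

instance : Algebra ℂ (Alg v) := inferInstanceAs (Algebra ℂ (RingQuot (Rel (v := v))))

variable (v) in
/-- The quotient map from the free algebra. -/
def mk : Free v →ₐ[ℂ] Alg v := RingQuot.mkAlgHom ℂ Rel

/-- The diagram `e(i)`. -/
def e (i : Seq v) : Alg v := mk v (fe i)

/-- The dot `y_k`. -/
def y (k : Fin (numStrands v)) : Alg v := mk v (fy k)

/-- The crossing `ψ_k`. -/
def psi (k : Pos (numStrands v)) : Alg v := mk v (fpsi k)

@[simp] theorem mk_fe (i : Seq v) : mk v (fe i) = e i := rfl

@[simp] theorem mk_fy (k : Fin (numStrands v)) : mk v (fy k) = y k := rfl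

@[simp] theorem mk_fpsi (k : Pos (numStrands v)) : mk v (fpsi k) = psi k := rfl

theorem rel_mk {a b : Free v} (h : Rel a b) :
    mk v a = mk v b :=
  RingQuot.mkAlgHom_rel ℂ h

/-! ### The reflection anti-automorphism -/

theorem e_mul_y (k) (i : Seq v) : e i * y k = y k * e i := by
  simpa using (rel_mk (Rel.y_e k i)).symm

theorem e_mul_psi (k) (i : Seq v) : e i * psi k = psi k * e (Seq.swap k i) := by
  simpa using (rel_mk (Rel.psi_e k (Seq.swap k i))).symm

theorem mul_e_mul_y (a : Alg v) (k) (i : Seq v) : a * e i * y k = a * y k * e i := by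
  rw [mul_assoc, e_mul_y, mul_assoc]

theorem mul_e_mul_psi (a : Alg v) (k) (i : Seq v) :
    a * e i * psi k = a * psi k * e (Seq.swap k i) := by
  rw [mul_assoc, e_mul_psi, mul_assoc]

theorem Seq.braid (k l : Pos (numStrands v)) (hkl : l.1 = k.1 + 1) (i : Seq v) :
    Seq.swap l (Seq.swap k (Seq.swap l i)) = Seq.swap k (Seq.swap l (Seq.swap k i)) := by
  have hl : l.lo = k.hi := Fin.ext hkl
  have h1 := k.lo_ne_hi
  have h2 := l.lo_ne_hi
  have h3 : k.lo ≠ l.hi := by simp only [Pos.lo, Pos.hi, ne_eq, Fin.mk.injEq]; omega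
  apply Subtype.ext; funext p
  simp only [Seq.swap_letter]
  rw [hl] at h2
  simp only [Pos.s, hl, Equiv.swap_apply_def]
  grind

theorem Seq.braid_letters (k l : Pos (numStrands v)) (hkl : l.1 = k.1 + 1) (i : Seq v) :
    (Seq.swap k (Seq.swap l (Seq.swap k i))).1 k.lo = i.1 l.hi ∧
    (Seq.swap k (Seq.swap l (Seq.swap k i))).1 k.hi = i.1 k.hi ∧
    (Seq.swap k (Seq.swap l (Seq.swap k i))).1 l.hi = i.1 k.lo := by
  have hl : l.lo = k.hi := Fin.ext hkl
  have h1 := k.lo_ne_hi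
  have h2 := l.lo_ne_hi
  have h3 : k.lo ≠ l.hi := by simp only [Pos.lo, Pos.hi, ne_eq, Fin.mk.injEq]; omega
  simp only [Seq.swap_letter]
  rw [hl] at h2
  simp only [Pos.s, hl, Equiv.swap_apply_def]
  grind

theorem Seq.braid_eq_self (k l : Pos (numStrands v)) (hkl : l.1 = k.1 + 1) (i : Seq v)
    (h : i.1 k.lo = i.1 l.hi) : Seq.swap k (Seq.swap l (Seq.swap k i)) = i := by
  have hl : l.lo = k.hi := Fin.ext hkl
  have h1 := k.lo_ne_hi
  have h2 := l.lo_ne_hi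
  have h3 : k.lo ≠ l.hi := by simp only [Pos.lo, Pos.hi, ne_eq, Fin.mk.injEq]; omega
  apply Subtype.ext; funext p
  simp only [Seq.swap_letter]
  rw [hl] at h2
  simp only [Pos.s, hl, Equiv.swap_apply_def]
  grind

/-- The images of the generators under the reflection in a horizontal line. -/
def reflGen : Gen v → (Alg v)ᵐᵒᵖ
  | .e i => MulOpposite.op (e i)
  | .y k => MulOpposite.op (y k)
  | .psi k => MulOpposite.op (psi k)

theorem reflGen_rel {a b : Free v} (h : Rel a b) :
    FreeAlgebra.lift ℂ reflGen a = FreeAlgebra.lift ℂ (reflGen (v := v)) b := by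
  apply MulOpposite.unop_injective
  cases h with
  | e_mul_self i => simpa [reflGen] using rel_mk (Rel.e_mul_self i)
  | e_mul_ne i j h => simpa [reflGen] using rel_mk (Rel.e_mul_ne j i h.symm)
  | sum_e => simpa [reflGen] using rel_mk (Rel.sum_e (v := v))
  | y_e k i => simpa [reflGen] using e_mul_y k i
  | psi_e k i => simpa [reflGen] using e_mul_psi k i
  | y_y k l => simpa [reflGen] using rel_mk (Rel.y_y l k)
  | psi_y k l h1 h2 => simpa [reflGen] using (rel_mk (Rel.psi_y k l h1 h2)).symm
  | psi_psi k l h => simpa [reflGen] using (rel_mk (Rel.psi_psi k l h)).symm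
  | red k i h1 h2 =>
    have hi : Seq.swap k i = i := Seq.swap_eq_self k i (by
      apply Fin.ext; simp only [IsRed, Seq.letter] at h1 h2; omega)
    have := rel_mk (Rel.red k i h1 h2)
    simpa [reflGen, e_mul_psi, hi] using this
  | slide_lo k i h =>
    have := rel_mk (Rel.slide_hi k (Seq.swap k i) (by simpa using h.symm))
    simp only [map_mul, mk_fe, mk_fy, mk_fpsi] at this
    simp [reflGen, ← mul_assoc, e_mul_psi, e_mul_y, mul_e_mul_psi, mul_e_mul_y, this]
  | slide_hi k i h =>
    have := rel_mk (Rel.slide_lo k (Seq.swap k i) (by simpa using h.symm))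
    simp only [map_mul, mk_fe, mk_fy, mk_fpsi] at this
    simp [reflGen, ← mul_assoc, e_mul_psi, e_mul_y, mul_e_mul_psi, mul_e_mul_y, this]
  | nil_lo k i h hr =>
    have hi : Seq.swap k i = i := Seq.swap_eq_self k i h
    have := rel_mk (Rel.nil_hi k i h hr)
    simp only [map_mul, map_sub, mk_fe, mk_fy, mk_fpsi, sub_mul] at this
    simp [reflGen, mul_sub, ← mul_assoc, e_mul_psi, e_mul_y, mul_e_mul_psi, mul_e_mul_y, hi, this]
  | nil_hi k i h hr =>
    have hi : Seq.swap k i = i := Seq.swap_eq_self k i h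
    have := rel_mk (Rel.nil_lo k i h hr)
    simp only [map_mul, map_sub, mk_fe, mk_fy, mk_fpsi, sub_mul] at this
    simp [reflGen, mul_sub, ← mul_assoc, e_mul_psi, e_mul_y, mul_e_mul_psi, mul_e_mul_y, hi, this]
  | bigon_eq k i h =>
    have := rel_mk (Rel.bigon_eq k i h)
    simp only [map_mul, map_zero, mk_fe, mk_fpsi] at this
    simp [reflGen, ← mul_assoc, e_mul_psi, mul_e_mul_psi, this]
  | bigon_far k i h h1 h2 =>
    have := rel_mk (Rel.bigon_far k i h h1 h2)
    simp only [map_mul, mk_fe, mk_fpsi] at this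
    simp [reflGen, ← mul_assoc, e_mul_psi, mul_e_mul_psi, this]
  | bigon_up k i h =>
    have := rel_mk (Rel.bigon_up k i h)
    simp only [map_mul, map_sub, mk_fe, mk_fy, mk_fpsi, sub_mul] at this
    simp [reflGen, mul_sub, ← mul_assoc, e_mul_psi, e_mul_y, mul_e_mul_psi, this]
  | bigon_down k i h =>
    have := rel_mk (Rel.bigon_down k i h)
    simp only [map_mul, map_sub, mk_fe, mk_fy, mk_fpsi, sub_mul] at this
    simp [reflGen, mul_sub, ← mul_assoc, e_mul_psi, e_mul_y, mul_e_mul_psi, this]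
  | triple_down k l hkl i h hr h1 =>
    have := rel_mk (Rel.triple_down k l hkl i h hr h1)
    simp only [map_mul, map_sub, mk_fe, mk_fpsi, sub_mul] at this
    simp [reflGen, mul_sub, ← mul_assoc, e_mul_psi, mul_e_mul_psi,
      Seq.braid k l hkl i, Seq.braid_eq_self k l hkl i h, this]
  | triple_up k l hkl i h h1 =>
    have := rel_mk (Rel.triple_up k l hkl i h h1)
    simp only [map_mul, map_sub, map_neg, mk_fe, mk_fpsi, sub_mul] at this
    simp [reflGen, mul_sub, ← mul_assoc, e_mul_psi, mul_e_mul_psi,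
      Seq.braid k l hkl i, Seq.braid_eq_self k l hkl i h, this]
  | triple_other k l hkl i h =>
    obtain ⟨q1, q2, q3⟩ := Seq.braid_letters k l hkl i
    have := rel_mk (Rel.triple_other k l hkl (Seq.swap k (Seq.swap l (Seq.swap k i))) (by
      simp only [Seq.letter, q1, q2, q3]
      intro hh
      apply h
      simp only [Seq.letter]
      exact ⟨hh.1.symm, hh.1 ▸ hh.2⟩))
    simp only [map_mul, map_sub, map_zero, mk_fe, mk_fpsi, sub_mul] at this
    simp [reflGen, mul_sub, ← mul_assoc, e_mul_psi, mul_e_mul_psi, Seq.braid k l hkl i, this]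

variable (v) in
/-- The reflection anti-automorphism, fixing all the generators `e i`, `y k`, `psi k`. -/
def refl : Alg v →ₐ[ℂ] (Alg v)ᵐᵒᵖ :=
  RingQuot.liftAlgHom ℂ ⟨FreeAlgebra.lift ℂ reflGen, fun _ _ h => reflGen_rel h⟩

/-! ## The polynomial representation -/

end

section
variable {V : ℕ}

/-- The automorphism `f ↦ f^(x,y)` of the polynomial ring exchanging the variables `x`, `y`. -/
abbrev tr (x z : Fin V) : MvPolynomial (Fin V) ℂ →ₐ[ℂ] MvPolynomial (Fin V) ℂ :=
  rename (Equiv.swap x z)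

theorem exists_divDiff (x z : Fin V) (f : MvPolynomial (Fin V) ℂ) :
    ∃ q, (X z - X x) * q = tr x z f - f := by
  induction f using MvPolynomial.induction_on with
  | C a => exact ⟨0, by simp⟩
  | add p q hp hq =>
    obtain ⟨a, ha⟩ := hp
    obtain ⟨b, hb⟩ := hq
    exact ⟨a + b, by rw [mul_add, ha, hb, map_add]; ring⟩
  | mul_X p w hp =>
    obtain ⟨a, ha⟩ := hp
    have hw : ∃ c, (X z - X x) * c = (tr x z (X w) - X w : MvPolynomial (Fin V) ℂ) := by
      by_cases h1 : w = x
      · exact ⟨1, by subst h1; simp⟩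
      by_cases h2 : w = z
      · exact ⟨-1, by subst h2; simp⟩
      · exact ⟨0, by simp [Equiv.swap_apply_of_ne_of_ne h1 h2]⟩
    obtain ⟨c, hc⟩ := hw
    exact ⟨a * X w + tr x z p * c, by rw [map_mul]; linear_combination X w * ha + tr x z p * hc⟩

theorem X_sub_X_ne_zero {x z : Fin V} (h : x ≠ z) : (X z - X x : MvPolynomial (Fin V) ℂ) ≠ 0 := by
  rw [sub_ne_zero]
  exact fun hh => h (X_injective hh).symm

/-- The divided difference operator `f ↦ (f^(x,z) - f) / (Y_z - Y_x)`. -/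
def divDiff (x z : Fin V) (h : x ≠ z) :
    MvPolynomial (Fin V) ℂ →ₗ[ℂ] MvPolynomial (Fin V) ℂ where
  toFun f := (exists_divDiff x z f).choose
  map_add' f g := by
    apply mul_left_cancel₀ (X_sub_X_ne_zero h)
    rw [mul_add, (exists_divDiff x z f).choose_spec, (exists_divDiff x z g).choose_spec,
      (exists_divDiff x z (f + g)).choose_spec, map_add]
    ring
  map_smul' c f := by
    apply mul_left_cancel₀ (X_sub_X_ne_zero h)
    rw [RingHom.id_apply, mul_smul_comm, (exists_divDiff x z f).choose_spec,
      (exists_divDiff x z (c • f)).choose_spec, map_smul, smul_sub]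

theorem divDiff_spec (x z : Fin V) (h : x ≠ z) (f : MvPolynomial (Fin V) ℂ) :
    (X z - X x) * divDiff x z h f = tr x z f - f :=
  (exists_divDiff x z f).choose_spec

/-- The operator by which a crossing of the strands `k`, `k + 1` acts, if `a` and `b` are the
labels of the strands `k` and `k + 1` at its bottom. -/
def crossOp {n : ℕ} (k : Pos V) (a b : Fin n) :
    MvPolynomial (Fin V) ℂ →ₗ[ℂ] MvPolynomial (Fin V) ℂ :=
  if a = b then
    if IsRed a then 0 else divDiff k.lo k.hi k.lo_ne_hi
  else if IsSucc a b then
    LinearMap.mulLeft ℂ (X k.lo - X k.hi) ∘ₗ (tr k.lo k.hi).toLinearMap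
  else (tr k.lo k.hi).toLinearMap

/-- The polynomial by which the crossing of differently labelled strands is twisted. -/
def twist {n : ℕ} (a b : Fin n) (x z : Fin V) : MvPolynomial (Fin V) ℂ :=
  if IsSucc a b then X x - X z else 1

theorem crossOp_ne {n : ℕ} (k : Pos V) {a b : Fin n} (h : a ≠ b) (f : MvPolynomial (Fin V) ℂ) :
    crossOp k a b f = twist a b k.lo k.hi * tr k.lo k.hi f := by
  simp only [crossOp, if_neg h, twist]
  split_ifs <;> simp

theorem crossOp_red {n : ℕ} (k : Pos V) {a : Fin n} (h : IsRed a) (f : MvPolynomial (Fin V) ℂ) :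
    crossOp k a a f = 0 := by
  simp [crossOp, h]

theorem crossOp_eq {n : ℕ} (k : Pos V) {a : Fin n} (h : ¬ IsRed a) (f : MvPolynomial (Fin V) ℂ) :
    (X k.hi - X k.lo) * crossOp k a a f = tr k.lo k.hi f - f := by
  simp [crossOp, h, divDiff_spec]

theorem tr_twist {n : ℕ} (a b : Fin n) (p q x z : Fin V) :
    tr p q (twist a b x z) = twist a b (Equiv.swap p q x) (Equiv.swap p q z) := by
  simp only [twist]
  split_ifs <;> simp

theorem tr_tr (p q : Fin V) (f : MvPolynomial (Fin V) ℂ) : tr p q (tr p q f) = f := by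
  rw [tr, rename_rename]
  have : (Equiv.swap p q : Fin V → Fin V) ∘ Equiv.swap p q = id := by funext w; simp
  rw [this, rename_id, AlgHom.id_apply]

theorem tr_comm {p q x z : Fin V} (h1 : p ≠ x) (h2 : p ≠ z) (h3 : q ≠ x) (h4 : q ≠ z)
    (f : MvPolynomial (Fin V) ℂ) : tr p q (tr x z f) = tr x z (tr p q f) := by
  simp only [tr, rename_rename]
  congr 2
  funext w
  simp only [Function.comp, Equiv.swap_apply_def]
  grind

theorem tr_braid {x z w : Fin V} (h1 : x ≠ z) (h2 : z ≠ w) (h3 : x ≠ w)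
    (f : MvPolynomial (Fin V) ℂ) :
    tr z w (tr x z (tr z w f)) = tr x z (tr z w (tr x z f)) := by
  simp only [tr, rename_rename]
  congr 2
  funext w
  simp only [Function.comp, Equiv.swap_apply_def]
  grind

theorem crossOp_mul_X_far {n : ℕ} (k : Pos V) (a b : Fin n) (l : Fin V) (h1 : l ≠ k.lo)
    (h2 : l ≠ k.hi) (f : MvPolynomial (Fin V) ℂ) :
    crossOp k a b (X l * f) = X l * crossOp k a b f := by
  have hl : tr k.lo k.hi (X l * f) = X l * tr k.lo k.hi f := by
    rw [map_mul, rename_X, Equiv.swap_apply_of_ne_of_ne h1 h2]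
  by_cases h : a = b
  · subst h
    by_cases hr : IsRed a
    · simp [crossOp_red k hr]
    · apply mul_left_cancel₀ (X_sub_X_ne_zero k.lo_ne_hi)
      have := crossOp_eq k hr f
      rw [crossOp_eq k hr, hl]
      linear_combination (-X l) * this
  · rw [crossOp_ne k h, crossOp_ne k h, hl]; ring

theorem crossOp_far {n : ℕ} (k l : Pos V) (hkl : k.1 + 1 < l.1) (a b c d : Fin n)
    (f : MvPolynomial (Fin V) ℂ) :
    crossOp k a b (crossOp l c d f) = crossOp l c d (crossOp k a b f) := by
  have e1 : k.lo ≠ l.lo := by simp only [Pos.lo, ne_eq, Fin.mk.injEq]; omega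
  have e2 : k.lo ≠ l.hi := by simp only [Pos.lo, Pos.hi, ne_eq, Fin.mk.injEq]; omega
  have e3 : k.hi ≠ l.lo := by simp only [Pos.lo, Pos.hi, ne_eq, Fin.mk.injEq]; omega
  have e4 : k.hi ≠ l.hi := by simp only [Pos.hi, ne_eq, Fin.mk.injEq]; omega
  have hk := X_sub_X_ne_zero k.lo_ne_hi
  have hl := X_sub_X_ne_zero l.lo_ne_hi
  have sk : ∀ g, tr k.lo k.hi ((X l.hi - X l.lo) * g) = (X l.hi - X l.lo) * tr k.lo k.hi g := by
    intro g
    rw [map_mul, map_sub, rename_X, rename_X, Equiv.swap_apply_of_ne_of_ne e2.symm e4.symm,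
      Equiv.swap_apply_of_ne_of_ne e1.symm e3.symm]
  have sl : ∀ g, tr l.lo l.hi ((X k.hi - X k.lo) * g) = (X k.hi - X k.lo) * tr l.lo l.hi g := by
    intro g
    rw [map_mul, map_sub, rename_X, rename_X, Equiv.swap_apply_of_ne_of_ne e3 e4,
      Equiv.swap_apply_of_ne_of_ne e1 e2]
  have tk : tr k.lo k.hi (twist c d l.lo l.hi) = twist c d l.lo l.hi := by
    rw [tr_twist, Equiv.swap_apply_of_ne_of_ne e2.symm e4.symm,
      Equiv.swap_apply_of_ne_of_ne e1.symm e3.symm]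
  have tl : tr l.lo l.hi (twist a b k.lo k.hi) = twist a b k.lo k.hi := by
    rw [tr_twist, Equiv.swap_apply_of_ne_of_ne e3 e4, Equiv.swap_apply_of_ne_of_ne e1 e2]
  have cm := tr_comm e1 e2 e3 e4
  by_cases hab : a = b
  · subst hab
    by_cases hr : IsRed a
    · simp [crossOp_red k hr]
    have A := crossOp_eq k hr
    by_cases hcd : c = d
    · subst hcd
      by_cases hr' : IsRed c
      · simp [crossOp_red l hr']
      have B := crossOp_eq l hr'
      apply mul_left_cancel₀ (mul_ne_zero hk hl)
      have u1 := A (crossOp l c c f)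
      have u2 := B (crossOp k a a f)
      have u3 := congrArg (tr k.lo k.hi) (B f)
      have u4 := congrArg (tr l.lo l.hi) (A f)
      rw [sk, map_sub, cm] at u3
      rw [sl, map_sub] at u4
      linear_combination (X l.hi - X l.lo) * u1 - (X k.hi - X k.lo) * u2 + u3 - u4 - B f + A f
    · rw [crossOp_ne l hcd, crossOp_ne l hcd]
      apply mul_left_cancel₀ hk
      have u4 := congrArg (tr l.lo l.hi) (A f)
      rw [sl, map_sub] at u4
      rw [A, map_mul, tk, cm]
      linear_combination (-twist c d l.lo l.hi) * u4
  · rw [crossOp_ne k hab, crossOp_ne k hab]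
    by_cases hcd : c = d
    · subst hcd
      by_cases hr' : IsRed c
      · simp [crossOp_red l hr']
      have B := crossOp_eq l hr'
      apply mul_left_cancel₀ hl
      have u3 := congrArg (tr k.lo k.hi) (B f)
      rw [sk, map_sub, cm] at u3
      rw [B, map_mul, tl]
      linear_combination (twist a b k.lo k.hi) * u3
    · rw [crossOp_ne l hcd, crossOp_ne l hcd, map_mul, map_mul, tk, tl, cm]
      ring

theorem crossOp_bigon_eq {n : ℕ} (k : Pos V) (a : Fin n) (f : MvPolynomial (Fin V) ℂ) :
    crossOp k a a (crossOp k a a f) = 0 := by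
  by_cases hr : IsRed a
  · simp [crossOp_red k hr]
  have hk := X_sub_X_ne_zero k.lo_ne_hi
  apply mul_left_cancel₀ (mul_ne_zero hk hk)
  have u1 := crossOp_eq k hr (crossOp k a a f)
  have u2 := crossOp_eq k hr f
  have u3 := congrArg (tr k.lo k.hi) u2
  rw [map_mul, map_sub, map_sub, tr_tr, rename_X, rename_X, Equiv.swap_apply_left,
    Equiv.swap_apply_right] at u3
  linear_combination (X k.hi - X k.lo) * u1 - u3 - u2

theorem crossOp_bigon_ne {n : ℕ} (k : Pos V) {a b : Fin n} (h : a ≠ b)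
    (f : MvPolynomial (Fin V) ℂ) :
    crossOp k b a (crossOp k a b f) = twist b a k.lo k.hi * twist a b k.hi k.lo * f := by
  rw [crossOp_ne k h.symm, crossOp_ne k h, map_mul, tr_tr, tr_twist, Equiv.swap_apply_left,
    Equiv.swap_apply_right]
  ring

theorem divDiff_triple_aux {R : Type*} [CommRing R] [IsDomain R] [Algebra ℂ R]
    (s t : R →ₐ[ℂ] R) (a b c : R)
    (hc : c = a + b) (ha : a ≠ 0) (sa : s a = -a) (sb : s b = c) (sc : s c = b) (ta : t a = c)
    (f g h l : R) (g1 : a * g = s f - f) (g2 : b * h = t g - g) (g3 : a * l = s h - h)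
    (hss : s (s f) = f) :
    a * b * c * l = s (t (s f)) - s (t f) - t (s f) + t f + s f - f := by
  have g4 := congrArg t g1
  have g5 := congrArg s g2
  have g6 := congrArg s g4
  have g7 := congrArg s g1
  simp only [map_mul, map_sub, sa, sb, sc, ta, hss] at g4 g5 g6 g7
  apply mul_left_cancel₀ ha
  subst hc
  linear_combination a * b * (a + b) * g3 + a * b * g5 + a * g6 + b * g7 - a * (a + b) * g2 -
    a * g4 + (a + b) * g1

/-- The difference of the two sides of the triple point relation. -/
def tripleOp {n : ℕ} (k l : Pos V) (a b c : Fin n) (f : MvPolynomial (Fin V) ℂ) :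
    MvPolynomial (Fin V) ℂ :=
  crossOp k b c (crossOp l a c (crossOp k a b f)) -
    crossOp l a b (crossOp k a c (crossOp l b c f))

theorem tripleOp_eq {n : ℕ} (k l : Pos V) (hkl : l.1 = k.1 + 1) (a b c : Fin n)
    (f : MvPolynomial (Fin V) ℂ) :
    tripleOp k l a b c f =
      if a = c ∧ ¬ IsRed a then
        if IsSucc b a then f else if IsSucc a b then -f else 0
      else 0 := by
  have hl : l.lo = k.hi := Fin.ext hkl
  have h1 := k.lo_ne_hi
  have h2 := l.lo_ne_hi
  have h3 : k.lo ≠ l.hi := by simp only [Pos.lo, Pos.hi, ne_eq, Fin.mk.injEq]; omega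
  have ek := fun {a : Fin n} (h : ¬ IsRed a) => crossOp_eq k h
  have el := fun {a : Fin n} (h : ¬ IsRed a) => crossOp_eq l h
  have nk := fun {a b : Fin n} (h : a ≠ b) => crossOp_ne k h
  have nl := fun {a b : Fin n} (h : a ≠ b) => crossOp_ne l h
  have rk := fun {a : Fin n} (h : IsRed a) => crossOp_red k h
  have rl := fun {a : Fin n} (h : IsRed a) => crossOp_red l h
  rw [hl] at h2 el nl
  generalize k.lo = x at *
  generalize k.hi = z at *
  generalize l.hi = w at *
  have hk := X_sub_X_ne_zero h1
  have hl' := X_sub_X_ne_zero h2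
  have hm := X_sub_X_ne_zero h3
  have br := tr_braid h1 h2 h3
  have b1 : Equiv.swap x z w = w := Equiv.swap_apply_of_ne_of_ne h3.symm h2.symm
  have b2 : Equiv.swap z w x = x := Equiv.swap_apply_of_ne_of_ne h1 h3
  have sx : tr x z (X x) = X z := by simp
  have sz : tr x z (X z) = X x := by simp
  have sw : tr x z (X w) = X w := by simp [b1]
  have ux : tr z w (X x) = X x := by simp [b2]
  have uz : tr z w (X z) = X w := by simp
  have uw : tr z w (X w) = X z := by simp
  unfold tripleOp
  by_cases hac : a = c
  · subst hac
    by_cases hr : IsRed a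
    · simp [rk hr, rl hr, hr]
    by_cases hab : a = b
    · subst hab
      have hs : ¬ IsSucc a a := by simp [IsSucc]
      simp only [hr, hs, not_false_eq_true, and_self, if_true, if_false]
      rw [sub_eq_zero]
      apply mul_left_cancel₀ (mul_ne_zero (mul_ne_zero hk hl') hm)
      rw [divDiff_triple_aux (tr x z) (tr z w) (X z - X x) (X w - X z) (X w - X x) (by ring) hk
        (by simp only [map_sub, sx, sz]; ring) (by simp only [map_sub, sw, sz])
        (by simp only [map_sub, sw, sx]) (by simp only [map_sub, uz, ux])
        f _ _ _ (ek hr _) (el hr _) (ek hr _) (tr_tr _ _ f)]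
      have := divDiff_triple_aux (tr z w) (tr x z) (X w - X z) (X z - X x) (X w - X x) (by ring) hl'
        (by simp only [map_sub, uw, uz]; ring) (by simp only [map_sub, ux, uz])
        (by simp only [map_sub, uw, ux]) (by simp only [map_sub, sw, sz])
        f _ _ _ (el hr _) (ek hr _) (el hr _) (tr_tr _ _ f)
      linear_combination -br f - this
    · have u1 := congrArg (tr x z) (el hr (crossOp k a b f))
      have u2 := congrArg (tr z w) (ek hr (crossOp l b a f))
      rw [nk hab] at u1
      rw [nl (Ne.symm hab)] at u2
      simp only [map_mul, map_sub, tr_twist, tr_tr, Equiv.swap_apply_left,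
        Equiv.swap_apply_right, b1, b2, rename_X] at u1 u2
      rw [nk hab, nk (Ne.symm hab), nl hab, nl (Ne.symm hab)]
      have key : twist a b z w * twist b a w z - twist b a x z * twist a b z x =
          (X w - X x) * (if IsSucc b a then 1 else if IsSucc a b then -1 else 0) := by
        by_cases g1 : IsSucc b a
        · have g2 : ¬ IsSucc a b := by simp only [IsSucc] at *; omega
          simp only [twist, g1, g2, if_true, if_false]; ring
        · simp only [twist, g1, if_false]
          split_ifs <;> ring
      have key2 : (if IsSucc b a then f else if IsSucc a b then -f else 0) =
          (if IsSucc b a then 1 else if IsSucc a b then -1 else 0) * f := by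
        split_ifs <;> ring
      simp only [hr, not_false_eq_true, and_self, if_true]
      rw [key2]
      apply mul_left_cancel₀ hm
      linear_combination twist b a x z * u1 - twist a b z w * u2 + f * key -
        twist b a x z * twist a b z w * br f
  · simp only [hac, false_and, if_false]
    rw [sub_eq_zero]
    by_cases hab : a = b
    · subst hab
      by_cases hr : IsRed a
      · simp [rk hr, rl hr]
      apply mul_left_cancel₀ hl'
      rw [el hr]
      have u := congrArg (fun q => tr x z (tr z w q)) (ek hr f)
      simp only [nk hac, nl hac, map_mul, map_sub, tr_twist, Equiv.swap_apply_left,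
        Equiv.swap_apply_right, b1, b2, rename_X] at u ⊢
      linear_combination twist a c x z * twist a c x w * (u - br f)
    · by_cases hbc : b = c
      · subst hbc
        by_cases hr : IsRed b
        · simp [rk hr, rl hr]
        apply mul_left_cancel₀ hk
        rw [ek hr]
        have u := congrArg (fun q => tr z w (tr x z q)) (el hr f)
        simp only [nk hab, nl hab, map_mul, map_sub, tr_twist, Equiv.swap_apply_left,
          Equiv.swap_apply_right, b1, b2, rename_X] at u ⊢
        linear_combination twist a b z w * twist a b x w * (-u - br f)
      · simp only [nk hab, nk hac, nk hbc, nl hab, nl hac, nl hbc, map_mul, tr_twist,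
          Equiv.swap_apply_left, Equiv.swap_apply_right, b1, b2]
        linear_combination (-(twist b c x z * twist a c x w * twist a b z w)) * br f

end

section
variable {n : ℕ} {v : Fin n → ℕ}

variable (v) in
/-- The space `P = ⨁_i ℂ[Y_1, …, Y_V] e(i)`, the sum being over the finite set `Seq(v)`. -/
abbrev Poly : Type := Seq v → MvPolynomial (Fin (numStrands v)) ℂ

/-- The element `f e(i)` of the polynomial representation. -/
abbrev single (i : Seq v) (f : MvPolynomial (Fin (numStrands v)) ℂ) : Poly v := Pi.single i f

/-- The action of the generators on the polynomial representation: `e i` projects to the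
summand of `i`, `y k` multiplies by `Y_k`, and `psi k` maps the summand of `i` to that of `s_k i`
by `crossOp`. -/
def polyGen : Gen v → Module.End ℂ (Poly v)
  | .e i => LinearMap.single ℂ _ i ∘ₗ LinearMap.proj i
  | .y k => LinearMap.pi fun j => LinearMap.mulLeft ℂ (X k) ∘ₗ LinearMap.proj j
  | .psi k => LinearMap.pi fun j =>
      crossOp k ((Seq.swap k j).letter k.lo) ((Seq.swap k j).letter k.hi) ∘ₗ
        LinearMap.proj (Seq.swap k j)

theorem polyGen_e (i : Seq v) (F : Poly v) : polyGen (.e i) F = single i (F i) := rfl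

theorem polyGen_e_self (i : Seq v) (f) : polyGen (.e i) (single i f) = single i f := by
  simp [polyGen_e]

theorem polyGen_e_ne {i j : Seq v} (h : i ≠ j) (f) : polyGen (.e i) (single j f) = 0 := by
  simp [polyGen_e, h]

theorem polyGen_y (k) (i : Seq v) (f) : polyGen (.y k) (single i f) = single i (X k * f) := by
  funext j
  by_cases h : j = i
  · subst h; simp [polyGen]
  · simp [polyGen, h]

theorem polyGen_psi (k) (i : Seq v) (f) :
    polyGen (.psi k) (single i f) =
      single (Seq.swap k i) (crossOp k (i.letter k.lo) (i.letter k.hi) f) := by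
  funext j
  by_cases h : j = Seq.swap k i
  · subst h; simp [polyGen]
  · have h' : Seq.swap k j ≠ i := fun hh => h (by rw [← hh, Seq.swap_swap])
    simp [polyGen, h, h']

theorem end_ext {A B : Module.End ℂ (Poly v)} (h : ∀ i f, A (single i f) = B (single i f)) :
    A = B :=
  LinearMap.pi_ext h

theorem end_ext_e {A B : Module.End ℂ (Poly v)} (i : Seq v)
    (h : ∀ f, A (single i f) = B (single i f)) :
    A * polyGen (.e i) = B * polyGen (.e i) :=
  LinearMap.ext fun F => h (F i)

theorem single_congr {i j : Seq v} (h : i = j) {f g} (h' : f = g) : single i f = single j g := by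
  rw [h, h']

theorem single_sub' (i : Seq v) (f g) : single i f - single i g = single i (f - g) :=
  (map_sub (LinearMap.single ℂ (fun _ : Seq v => MvPolynomial (Fin (numStrands v)) ℂ) i) f g).symm

theorem triple_apply (k l : Pos (numStrands v)) (hkl : l.1 = k.1 + 1) (i : Seq v) (f) :
    (polyGen (.psi k) * polyGen (.psi l) * polyGen (.psi k) -
      polyGen (.psi l) * polyGen (.psi k) * polyGen (.psi l)) (single i f) =
    single (Seq.swap k (Seq.swap l (Seq.swap k i)))
      (if i.letter k.lo = i.letter l.hi ∧ ¬ IsRed (i.letter k.lo) then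
        if IsSucc (i.letter k.hi) (i.letter k.lo) then f
        else if IsSucc (i.letter k.lo) (i.letter k.hi) then -f else 0
      else 0) := by
  rw [← tripleOp_eq k l hkl]
  have hl : l.lo = k.hi := Fin.ext hkl
  have h1 := k.lo_ne_hi
  have h2 := l.lo_ne_hi
  have h3 : k.lo ≠ l.hi := by simp only [Pos.lo, Pos.hi, ne_eq, Fin.mk.injEq]; omega
  rw [hl] at h2
  simp only [LinearMap.sub_apply, Module.End.mul_apply, polyGen_psi, Seq.braid k l hkl, single_sub']
  simp only [Seq.letter, Seq.swap_letter, Pos.s, hl, Equiv.swap_apply_left,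
    Equiv.swap_apply_right, Equiv.swap_apply_of_ne_of_ne h3.symm h2.symm,
    Equiv.swap_apply_of_ne_of_ne h1 h3]
  rfl

theorem polyGen_rel {a b : Free v} (h : Rel a b) :
    FreeAlgebra.lift ℂ polyGen a = FreeAlgebra.lift ℂ (polyGen (v := v)) b := by
  cases h with
  | e_mul_self i =>
    simp only [map_mul, FreeAlgebra.lift_ι_apply]
    refine LinearMap.ext fun F => ?_
    simp [polyGen_e]
  | e_mul_ne i j h =>
    simp only [map_mul, map_zero, FreeAlgebra.lift_ι_apply]
    refine LinearMap.ext fun F => ?_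
    simp [polyGen_e, h]
  | sum_e =>
    simp only [map_sum, map_one, FreeAlgebra.lift_ι_apply]
    refine LinearMap.ext fun F => ?_
    simp [LinearMap.sum_apply, polyGen_e, Finset.univ_sum_single]
  | y_e k i =>
    simp only [map_mul, FreeAlgebra.lift_ι_apply]
    refine end_ext fun j f => ?_
    by_cases h : i = j
    · subst h; simp [polyGen_e_self, polyGen_y]
    · simp [polyGen_e_ne h, polyGen_y]
  | psi_e k i =>
    simp only [map_mul, FreeAlgebra.lift_ι_apply]
    refine end_ext fun j f => ?_
    by_cases h : i = j
    · subst h; simp [polyGen_e_self, polyGen_psi]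
    · have h' : Seq.swap k i ≠ Seq.swap k j := fun hh => h (by
        rw [← Seq.swap_swap k i, hh, Seq.swap_swap])
      simp [polyGen_e_ne h, polyGen_e_ne h', polyGen_psi]
  | y_y k l =>
    simp only [map_mul, FreeAlgebra.lift_ι_apply]
    refine end_ext fun j f => ?_
    simp only [Module.End.mul_apply, polyGen_y]
    exact single_congr rfl (by ring)
  | psi_y k l h1 h2 =>
    simp only [map_mul, FreeAlgebra.lift_ι_apply]
    refine end_ext fun j f => ?_
    simp only [Module.End.mul_apply, polyGen_y, polyGen_psi]
    exact single_congr rfl (crossOp_mul_X_far k _ _ l h1 h2 f)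
  | psi_psi k l h =>
    simp only [map_mul, FreeAlgebra.lift_ι_apply]
    refine end_ext fun j f => ?_
    have e1 : k.lo ≠ l.lo := by simp only [Pos.lo, ne_eq, Fin.mk.injEq]; omega
    have e2 : k.lo ≠ l.hi := by simp only [Pos.lo, Pos.hi, ne_eq, Fin.mk.injEq]; omega
    have e3 : k.hi ≠ l.lo := by simp only [Pos.lo, Pos.hi, ne_eq, Fin.mk.injEq]; omega
    have e4 : k.hi ≠ l.hi := by simp only [Pos.hi, ne_eq, Fin.mk.injEq]; omega
    simp only [Module.End.mul_apply, polyGen_psi, Seq.letter, Seq.swap_letter, Pos.s,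
      Equiv.swap_apply_of_ne_of_ne e1 e2, Equiv.swap_apply_of_ne_of_ne e3 e4,
      Equiv.swap_apply_of_ne_of_ne e1.symm e3.symm, Equiv.swap_apply_of_ne_of_ne e2.symm e4.symm]
    refine single_congr ?_ (crossOp_far k l h _ _ _ _ f)
    apply Subtype.ext; funext p
    simp only [Seq.swap_letter]
    simp only [Pos.s, Equiv.swap_apply_def]
    grind
  | red k i h1 h2 =>
    have h : i.letter k.lo = i.letter k.hi := by
      apply Fin.ext; simp only [IsRed] at h1 h2; omega
    simp only [map_mul, map_zero, FreeAlgebra.lift_ι_apply]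
    rw [← zero_mul (polyGen (.e i))]
    refine end_ext_e i fun f => ?_
    rw [polyGen_psi, ← h, crossOp_red k h1]; simp
  | slide_lo k i h =>
    simp only [map_mul, FreeAlgebra.lift_ι_apply]
    refine end_ext_e i fun f => ?_
    simp only [Module.End.mul_apply, polyGen_y, polyGen_psi]
    refine single_congr rfl ?_
    rw [crossOp_ne k h, crossOp_ne k h, map_mul, rename_X, Equiv.swap_apply_right]; ring
  | slide_hi k i h =>
    simp only [map_mul, FreeAlgebra.lift_ι_apply]
    refine end_ext_e i fun f => ?_
    simp only [Module.End.mul_apply, polyGen_y, polyGen_psi]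
    refine single_congr rfl ?_
    rw [crossOp_ne k h, crossOp_ne k h, map_mul, rename_X, Equiv.swap_apply_left]; ring
  | nil_lo k i h hr =>
    simp only [map_mul, map_sub, FreeAlgebra.lift_ι_apply]
    nth_rewrite 2 [← one_mul (polyGen (.e i))]
    refine end_ext_e i fun f => ?_
    simp only [Module.End.mul_apply, LinearMap.sub_apply, polyGen_y, polyGen_psi,
      Seq.swap_eq_self k i h, single_sub', Module.End.one_apply]
    refine single_congr rfl ?_
    rw [← h]
    apply mul_left_cancel₀ (X_sub_X_ne_zero k.lo_ne_hi)
    have u1 := crossOp_eq k hr f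
    have u2 := crossOp_eq k hr (X k.hi * f)
    rw [map_mul (tr k.lo k.hi), rename_X, Equiv.swap_apply_right] at u2
    linear_combination X k.lo * u1 - u2
  | nil_hi k i h hr =>
    simp only [map_mul, map_sub, FreeAlgebra.lift_ι_apply]
    nth_rewrite 2 [← one_mul (polyGen (.e i))]
    refine end_ext_e i fun f => ?_
    simp only [Module.End.mul_apply, LinearMap.sub_apply, polyGen_y, polyGen_psi,
      Seq.swap_eq_self k i h, single_sub', Module.End.one_apply]
    refine single_congr rfl ?_
    rw [← h]
    apply mul_left_cancel₀ (X_sub_X_ne_zero k.lo_ne_hi)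
    have u1 := crossOp_eq k hr f
    have u2 := crossOp_eq k hr (X k.lo * f)
    rw [map_mul (tr k.lo k.hi), rename_X, Equiv.swap_apply_left] at u2
    linear_combination -X k.hi * u1 + u2
  | bigon_eq k i h =>
    simp only [map_mul, map_zero, FreeAlgebra.lift_ι_apply]
    rw [← zero_mul (polyGen (.e i))]
    refine end_ext_e i fun f => ?_
    simp only [Module.End.mul_apply, polyGen_psi, Seq.swap_eq_self k i h]
    rw [← h, crossOp_bigon_eq]; simp
  | bigon_far k i h h1 h2 =>
    simp only [map_mul, FreeAlgebra.lift_ι_apply]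
    nth_rewrite 2 [← one_mul (polyGen (.e i))]
    refine end_ext_e i fun f => ?_
    simp only [Module.End.mul_apply, polyGen_psi, Seq.letter, Seq.swap_letter,
      Equiv.swap_apply_left, Equiv.swap_apply_right, Seq.swap_swap, Module.End.one_apply]
    refine single_congr rfl ?_
    rw [crossOp_bigon_ne k h]
    simp only [Seq.letter] at h1 h2
    simp [twist, h1, h2]
  | bigon_up k i h =>
    have hne : i.letter k.lo ≠ i.letter k.hi := by
      intro hh; rw [hh] at h; simp [IsSucc] at h
    have h2 : ¬ IsSucc (i.letter k.hi) (i.letter k.lo) := by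
      simp only [IsSucc] at *; omega
    simp only [map_mul, map_sub, FreeAlgebra.lift_ι_apply]
    refine end_ext_e i fun f => ?_
    simp only [Module.End.mul_apply, LinearMap.sub_apply, polyGen_psi, polyGen_y, Seq.letter,
      Seq.swap_letter, Equiv.swap_apply_left, Equiv.swap_apply_right, Seq.swap_swap, single_sub']
    refine single_congr rfl ?_
    rw [crossOp_bigon_ne k hne]
    simp only [Seq.letter] at h h2
    simp only [twist, h, h2, if_true, if_false]
    ring
  | bigon_down k i h =>
    have hne : i.letter k.lo ≠ i.letter k.hi := by
      intro hh; rw [hh] at h; simp [IsSucc] at h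
    have h2 : ¬ IsSucc (i.letter k.lo) (i.letter k.hi) := by
      simp only [IsSucc] at *; omega
    simp only [map_mul, map_sub, FreeAlgebra.lift_ι_apply]
    refine end_ext_e i fun f => ?_
    simp only [Module.End.mul_apply, LinearMap.sub_apply, polyGen_psi, polyGen_y, Seq.letter,
      Seq.swap_letter, Equiv.swap_apply_left, Equiv.swap_apply_right, Seq.swap_swap, single_sub']
    refine single_congr rfl ?_
    rw [crossOp_bigon_ne k hne]
    simp only [Seq.letter] at h h2
    simp only [twist, h, h2, if_true, if_false]
    ring
  | triple_down k l hkl i h hr h1 =>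
    simp only [map_mul, map_sub, FreeAlgebra.lift_ι_apply]
    nth_rewrite 2 [← one_mul (polyGen (.e i))]
    refine end_ext_e i fun f => ?_
    rw [triple_apply k l hkl, Seq.braid_eq_self k l hkl i h, if_pos ⟨h, hr⟩, if_pos h1]
    rfl
  | triple_up k l hkl i h h1 =>
    have hr : ¬ IsRed (i.letter k.lo) := by
      have := (i.letter k.hi).2
      simp only [IsRed, IsSucc] at *; omega
    have h2 : ¬ IsSucc (i.letter k.hi) (i.letter k.lo) := by
      simp only [IsSucc] at *; omega
    simp only [map_mul, map_sub, map_neg, FreeAlgebra.lift_ι_apply]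
    rw [← neg_one_mul (polyGen (.e i))]
    refine end_ext_e i fun f => ?_
    rw [triple_apply k l hkl, Seq.braid_eq_self k l hkl i h, if_pos ⟨h, hr⟩, if_neg h2,
      if_pos h1]
    simp [single, Pi.single_neg]
  | triple_other k l hkl i h =>
    simp only [map_mul, map_sub, map_zero, FreeAlgebra.lift_ι_apply]
    rw [← zero_mul (polyGen (.e i))]
    refine end_ext_e i fun f => ?_
    rw [triple_apply k l hkl]
    have : (if i.letter k.lo = i.letter l.hi ∧ ¬ IsRed (i.letter k.lo) then
        if IsSucc (i.letter k.hi) (i.letter k.lo) then f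
        else if IsSucc (i.letter k.lo) (i.letter k.hi) then -f else 0
      else 0) = 0 := by
      split_ifs with g1 g2 g3
      · exact absurd ⟨g1.1, Or.inl g2⟩ h
      · exact absurd ⟨g1.1, Or.inr g3⟩ h
      · rfl
      · rfl
    rw [this]; simp

variable (v) in
/-- The polynomial representation of the KLRW algebra. -/
def polyRep : Alg v →ₐ[ℂ] Module.End ℂ (Poly v) :=
  RingQuot.liftAlgHom ℂ ⟨FreeAlgebra.lift ℂ polyGen, fun _ _ h => polyGen_rel h⟩

/-! ## Canonical modules -/

variable (v) in
/-- The dual space of the polynomial representation, as a left module over the KLRW algebra via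
the reflection anti-automorphism. -/
def DualPoly : Type := Module.Dual ℂ (Poly v)

instance : AddCommGroup (DualPoly v) := inferInstanceAs (AddCommGroup (Module.Dual ℂ (Poly v)))

/-- `(a • φ)(F) = φ (a^* F)`, where `a^*` is the reflection of `a`. -/
instance : Module (Alg v) (DualPoly v) where
  smul a φ := LinearMap.comp (φ : Module.Dual ℂ (Poly v)) (polyRep v (refl v a).unop)
  one_smul φ := by
    change LinearMap.comp (φ : Module.Dual ℂ (Poly v)) (polyRep v (refl v 1).unop) = φ
    simp only [map_one, MulOpposite.unop_one]
    rfl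
  mul_smul a b φ := by
    change LinearMap.comp (φ : Module.Dual ℂ (Poly v)) (polyRep v (refl v (a * b)).unop) = _
    simp only [map_mul, MulOpposite.unop_mul]
    rfl
  smul_zero a := LinearMap.zero_comp _
  smul_add a φ χ := LinearMap.add_comp _ _ _
  add_smul a b φ := by
    change LinearMap.comp (φ : Module.Dual ℂ (Poly v)) (polyRep v (refl v (a + b)).unop) = _
    simp only [map_add, MulOpposite.unop_add]
    exact LinearMap.comp_add _ _ _
  zero_smul φ := by
    change LinearMap.comp (φ : Module.Dual ℂ (Poly v)) (polyRep v (refl v 0).unop) = _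
    simp only [map_zero, MulOpposite.unop_zero]
    exact LinearMap.comp_zero _

/-- The functional `ev_i` of degree 0 with `ev_i (e(j)) = δ_ij`: it sends `f e(i)` to `f(0)` and
kills the other summands. -/
def ev (i : Seq v) : DualPoly v :=
  (LinearMap.comp (MvPolynomial.lcoeff ℂ (0 : Fin (numStrands v) →₀ ℕ)) (LinearMap.proj i) :
    Poly v →ₗ[ℂ] ℂ)

/-- `N'(i)`: the submodule generated by `ev_i`.  (As `ev_i` is homogeneous, this is the same
submodule whether it is formed in the full dual or in the restricted dual, the span of the
homogeneous functionals.) -/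
def NPrime (i : Seq v) : Submodule (Alg v) (DualPoly v) := Submodule.span (Alg v) {ev i}

/-- `N(i)`: the quotient of `N'(i)` by the intersection of its maximal submodules.  When `N'(i)`
has exactly one maximal submodule, this is its unique simple quotient. -/
abbrev N (i : Seq v) : Type := NPrime i ⧸ Module.jacobson (Alg v) (NPrime i)

/-! ## The moves -/

/-- `Move i j`: the word `j` is obtained from `i` by one of the three elementary moves. -/
inductive Move : Seq v → Seq v → Prop
  /-- `(…, r, s, …) → (…, s, r, …)` with `r ≠ s ± 1`. -/
  | far (k : Pos (numStrands v)) (i : Seq v)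
      (h1 : ¬ IsSucc (i.letter k.lo) (i.letter k.hi))
      (h2 : ¬ IsSucc (i.letter k.hi) (i.letter k.lo)) : Move i (Seq.swap k i)
  /-- `(…, r, r - 1, r, …) → (…, r, r, r - 1, …)` with `r < n`, in the positions `k`, `k + 1`,
  `l + 1 = k + 2`. -/
  | down (k l : Pos (numStrands v)) (hkl : l.1 = k.1 + 1) (i : Seq v)
      (h : i.letter k.lo = i.letter l.hi) (hr : ¬ IsRed (i.letter k.lo))
      (h1 : IsSucc (i.letter k.hi) (i.letter k.lo)) : Move i (Seq.swap l i)
  /-- `(…, r, r + 1, r, …) → (…, r + 1, r, r, …)` with `r < n`, in the positions `k`, `k + 1`,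
  `l + 1 = k + 2`. -/
  | up (k l : Pos (numStrands v)) (hkl : l.1 = k.1 + 1) (i : Seq v)
      (h : i.letter k.lo = i.letter l.hi) (hr : ¬ IsRed (i.letter k.lo))
      (h1 : IsSucc (i.letter k.lo) (i.letter k.hi)) : Move i (Seq.swap k i)

end

end

end KLRW

/-!
The word `i` determines the submodule `N'(i)` of the dual of the polynomial representation, and the
proof shows that `N(i) ≅ N(j)`, `N'(i) = N'(j)` and equivalence of `i` and `j` under the moves are
the same thing.

Every functional in `N'(i)` has bounded degree, since crossings lower the order of a polynomial at
the origin by at most one.  If a functional of bounded degree does not vanish on the summand of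
`j`, then multiplying it by a suitable polynomial in the dots turns it into a nonzero multiple of
`ev j` (`exists_smul_eq_ev`).  Hence an element of `N'(i)` that does not annihilate the submodule
generated by `1 e(i)` generates `N'(i)`, and the remaining elements form the only maximal submodule
(`existsUnique_isCoatom`).  For the same reason an isomorphism `N(i) ≅ N(j)` forces `ev i ∈ N'(j)`
and `ev j ∈ N'(i)`, that is, `N'(i) = N'(j)` (`ev_mem_NPrime_of_equiv`).  Conversely, a move does
not change `N'(i)` (`Move.NPrime_eq`): one direction of a move is a single crossing acting by an
exchange of variables, the other one such a crossing or the product of a crossing with a divided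
difference, which maps `1` to a nonzero constant.

It remains to show that `N'(i) = N'(j)` implies that `i` and `j` are related by moves.
Geometrically, `i` labels the variety of representations of a linear quiver that have a flag of type `i`, and one
restricts to the torus fixed points over a direct sum of indecomposables.  In algebraic terms, let
`y` be a list of intervals of labels, the segments, and give each segment its own number `c`.  For
each way to write a word as a shuffle of the segments, read downwards, there is a point whose
coordinates are the numbers of the segments to which the letters belong.  The polynomials that
vanish at all these points and their multiples form a submodule of the polynomial representation
(`polyGen_mem_vanishing`), and it contains `1 e(i)` if and only if `i` is not such a shuffle.
Therefore `ev i ∈ N'(j)` implies that `i` is a shuffle of every multisegment that `j` is a shuffle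
of (`exists_isShuffle_of_ev_mem`).

Finally, the moves bring every word into a normal form, the concatenation of the segments of a
sorted list (`exists_eqvGen_word`): a black letter commutes with every segment that contains it.
Counting the segments that contain a given interval shows that two normal forms each of which is a
shuffle of the segments of the other coincide (`eq_of_isShuffle`).
-/

namespace KLRW

open MvPolynomial

noncomputable section

variable {n : ℕ} {v : Fin n → ℕ}

/-! ### The action of the generators -/

/-- Induction over the KLRW algebra: a property of its elements holds if it holds for scalars and
generators and is closed under sums and products. -/
theorem alg_induction {C : Alg v → Prop} (hr : ∀ r : ℂ, C (algebraMap ℂ (Alg v) r))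
    (he : ∀ i, C (e i)) (hy : ∀ k, C (y k)) (hpsi : ∀ k, C (psi k))
    (hadd : ∀ a b, C a → C b → C (a + b)) (hmul : ∀ a b, C a → C b → C (a * b))
    (a : Alg v) : C a := by
  obtain ⟨x, rfl⟩ : ∃ x, mk v x = a := RingQuot.mkAlgHom_surjective ℂ Rel a
  induction x using FreeAlgebra.induction with
  | grade0 r => simpa using hr r
  | grade1 g =>
    cases g with
    | e i => exact he i
    | y k => exact hy k
    | psi k => exact hpsi k
  | mul a b ha hb => simpa using hmul _ _ ha hb
  | add a b ha hb => simpa using hadd _ _ ha hb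

theorem refl_mk (x : Free v) : refl v (mk v x) = FreeAlgebra.lift ℂ reflGen x :=
  RingQuot.liftAlgHom_mkAlgHom_apply ..

theorem polyRep_mk (x : Free v) : polyRep v (mk v x) = FreeAlgebra.lift ℂ polyGen x :=
  RingQuot.liftAlgHom_mkAlgHom_apply ..

@[simp] theorem refl_e (i : Seq v) : refl v (e i) = MulOpposite.op (e i) := by
  simp [← mk_fe, refl_mk, reflGen]

@[simp] theorem refl_y (k) : refl v (y k) = MulOpposite.op (y k) := by
  simp [← mk_fy, refl_mk, reflGen]

@[simp] theorem refl_psi (k) : refl v (psi k) = MulOpposite.op (psi k) := by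
  simp [← mk_fpsi, refl_mk, reflGen]

@[simp] theorem polyRep_e (i : Seq v) : polyRep v (e i) = polyGen (.e i) := by
  simp [← mk_fe, polyRep_mk]

@[simp] theorem polyRep_y (k) : polyRep v (y k) = polyGen (.y k) := by
  simp [← mk_fy, polyRep_mk]

@[simp] theorem polyRep_psi (k) : polyRep v (psi k) = polyGen (.psi k) := by
  simp [← mk_fpsi, polyRep_mk]

/-- A subspace of the polynomial representation that is stable under dots and crossings and under
the projections `e i` is stable under the whole algebra. -/
theorem polyRep_mem_of_stable (U : Submodule ℂ (Poly v))
    (h : ∀ (g : Gen v), ∀ F ∈ U, polyGen g F ∈ U) (a : Alg v) :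
    ∀ F ∈ U, polyRep v a F ∈ U := by
  induction a using alg_induction with
  | hr r =>
    intro F hF
    rw [AlgHom.commutes, Module.algebraMap_end_apply]
    exact U.smul_mem _ hF
  | he i => simpa using h (.e i)
  | hy k => simpa using h (.y k)
  | hpsi k => simpa using h (.psi k)
  | hadd a b ha hb =>
    intro F hF
    rw [map_add]
    exact U.add_mem (ha F hF) (hb F hF)
  | hmul a b ha hb =>
    intro F hF
    rw [map_mul]
    exact ha _ (hb F hF)

/-- The value of an element of the dual of the polynomial representation. -/
def pair (φ : DualPoly v) : Poly v →ₗ[ℂ] ℂ := φ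

theorem pair_injective {φ χ : DualPoly v} (h : ∀ i f, pair φ (single i f) = pair χ (single i f)) :
    φ = χ :=
  LinearMap.pi_ext h

theorem single_self (i : Seq v) (f) : single i f i = f := by simp

theorem single_of_ne {i j : Seq v} (h : j ≠ i) (f) : single i f j = 0 := by simp [h]

theorem pair_smul (a : Alg v) (φ : DualPoly v) (F : Poly v) :
    pair (a • φ) F = pair φ (polyRep v (refl v a).unop F) := rfl

theorem pair_add (φ χ : DualPoly v) (F : Poly v) : pair (φ + χ) F = pair φ F + pair χ F := rfl

theorem pair_zero (F : Poly v) : pair 0 F = 0 := rfl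

theorem pair_algebraMap_smul (r : ℂ) (φ : DualPoly v) (F : Poly v) :
    pair (algebraMap ℂ (Alg v) r • φ) F = r * pair φ F := by
  rw [pair_smul, AlgHom.commutes, MulOpposite.algebraMap_apply, MulOpposite.unop_op,
    AlgHom.commutes, Module.algebraMap_end_apply, map_smul, smul_eq_mul]

theorem pair_ev (i : Seq v) (F : Poly v) : pair (ev i) F = constantCoeff (F i) := rfl

theorem e_smul_ev (i : Seq v) : e i • ev i = ev i := by
  refine pair_injective fun j f => ?_
  simp [pair_smul, pair_ev, polyGen_e]

theorem pair_e_smul (i : Seq v) (φ : DualPoly v) (F : Poly v) :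
    pair (e i • φ) F = pair φ (single i (F i)) := by
  simp [pair_smul, polyGen_e]

theorem mem_NPrime {i : Seq v} {φ : DualPoly v} : φ ∈ NPrime i ↔ ∃ a : Alg v, a • ev i = φ :=
  Submodule.mem_span_singleton

theorem ev_mem_NPrime (i : Seq v) : ev i ∈ NPrime i := Submodule.mem_span_singleton_self _

/-! ### Functionals of bounded degree -/

section
variable {V : ℕ}

variable (V) in
/-- The ideal of the polynomials without constant term. -/
abbrev augIdeal : Ideal (MvPolynomial (Fin V) ℂ) := RingHom.ker constantCoeff

theorem divDiff_mul (x z : Fin V) (h : x ≠ z) (f g : MvPolynomial (Fin V) ℂ) :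
    divDiff x z h (f * g) = divDiff x z h f * g + tr x z f * divDiff x z h g := by
  apply mul_left_cancel₀ (X_sub_X_ne_zero h)
  have h1 := divDiff_spec x z h f
  have h2 := divDiff_spec x z h g
  rw [divDiff_spec, map_mul]
  linear_combination -g * h1 - tr x z f * h2

theorem tr_mem_pow (x z : Fin V) (D : ℕ) {f : MvPolynomial (Fin V) ℂ}
    (hf : f ∈ augIdeal V ^ D) : tr x z f ∈ augIdeal V ^ D := by
  have h : (augIdeal V ^ D).map (tr x z : _ →ₐ[ℂ] _).toRingHom ≤ augIdeal V ^ D := by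
    rw [Ideal.map_pow]
    refine Ideal.pow_right_mono (Ideal.map_le_iff_le_comap.2 fun p hp => ?_) D
    simp only [RingHom.mem_ker, Ideal.mem_comap] at hp ⊢
    rw [← hp]
    exact constantCoeff_rename _ p
  exact h (Ideal.mem_map_of_mem _ hf)

theorem divDiff_mem_pow (x z : Fin V) (h : x ≠ z) (D : ℕ) :
    ∀ f ∈ augIdeal V ^ (D + 1), divDiff x z h f ∈ augIdeal V ^ D := by
  induction D with
  | zero => intro f _; simp
  | succ D ih =>
    intro f hf
    rw [pow_succ'] at hf
    refine Submodule.mul_induction_on hf (fun p hp q hq => ?_) (fun p q hp hq => ?_)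
    · rw [divDiff_mul]
      refine add_mem (Ideal.mul_mem_left _ _ hq) ?_
      rw [pow_succ']
      refine Ideal.mul_mem_mul ?_ (ih q hq)
      simpa using tr_mem_pow x z 1 (by simpa using hp)
    · rw [map_add]
      exact add_mem hp hq

theorem crossOp_mem_pow (k : Pos V) (a b : Fin n) (D : ℕ) {f : MvPolynomial (Fin V) ℂ}
    (hf : f ∈ augIdeal V ^ (D + 1)) : crossOp k a b f ∈ augIdeal V ^ D := by
  by_cases h : a = b
  · subst h
    simp only [crossOp, if_true]
    split_ifs
    · simp
    · exact divDiff_mem_pow _ _ _ D f hf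
  · rw [crossOp_ne k h]
    exact Ideal.mul_mem_left _ _ (tr_mem_pow _ _ D (Ideal.pow_le_pow_right (Nat.le_succ D) hf))

end

/-- The elements of the polynomial representation all of whose components have order at least `D`
at the origin. -/
def order (v : Fin n → ℕ) (D : ℕ) : Set (Poly v) :=
  {F | ∀ j, F j ∈ augIdeal (numStrands v) ^ D}

theorem order_anti {D E : ℕ} (h : D ≤ E) : order v E ⊆ order v D :=
  fun _ hF j => Ideal.pow_le_pow_right h (hF j)

/-- Every element of the algebra lowers the order at the origin by a bounded amount. -/
theorem exists_polyRep_mem_order (a : Alg v) :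
    ∃ c, ∀ D, ∀ F ∈ order v (D + c), polyRep v a F ∈ order v D := by
  induction a using alg_induction with
  | hr r =>
    refine ⟨0, fun D F hF j => ?_⟩
    rw [AlgHom.commutes, Module.algebraMap_end_apply, Pi.smul_apply, smul_eq_C_mul]
    exact Ideal.mul_mem_left _ _ (hF j)
  | he i =>
    refine ⟨0, fun D F hF j => ?_⟩
    rw [polyRep_e, polyGen_e]
    by_cases h : j = i
    · subst h
      simpa using hF j
    · simp [h]
  | hy k =>
    refine ⟨0, fun D F hF j => ?_⟩
    rw [polyRep_y]
    exact Ideal.mul_mem_left _ _ (hF j)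
  | hpsi k =>
    refine ⟨1, fun D F hF j => ?_⟩
    rw [polyRep_psi]
    exact crossOp_mem_pow k _ _ D (hF _)
  | hadd a b ha hb =>
    obtain ⟨c, hc⟩ := ha
    obtain ⟨d, hd⟩ := hb
    refine ⟨c + d, fun D F hF j => ?_⟩
    rw [map_add]
    exact add_mem (hc D F (order_anti (by omega) hF) j) (hd D F (order_anti (by omega) hF) j)
  | hmul a b ha hb =>
    obtain ⟨c, hc⟩ := ha
    obtain ⟨d, hd⟩ := hb
    refine ⟨c + d, fun D F hF => ?_⟩
    rw [map_mul]
    exact hc D _ (hd _ F (by rwa [add_assoc]))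

theorem exists_pair_eq_zero_of_mem_NPrime {i : Seq v} {φ : DualPoly v} (hφ : φ ∈ NPrime i) :
    ∃ D, ∀ F ∈ order v D, pair φ F = 0 := by
  obtain ⟨a, rfl⟩ := mem_NPrime.1 hφ
  obtain ⟨c, hc⟩ := exists_polyRep_mem_order (refl v a).unop
  refine ⟨1 + c, fun F hF => ?_⟩
  have := hc 1 F hF i
  rwa [pow_one] at this

/-- Multiplication by a polynomial is the action of an element of the algebra. -/
theorem exists_polyRep_eq_mul (g : MvPolynomial (Fin (numStrands v)) ℂ) :
    ∃ a : Alg v, ∀ i f, polyRep v (refl v a).unop (single i f) = single i (g * f) := by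
  induction g using MvPolynomial.induction_on with
  | C r =>
    refine ⟨algebraMap ℂ _ r, fun i f => ?_⟩
    rw [AlgHom.commutes, MulOpposite.algebraMap_apply, MulOpposite.unop_op,
      AlgHom.commutes, Module.algebraMap_end_apply, ← Pi.single_smul, smul_eq_C_mul]
  | add p q hp hq =>
    obtain ⟨a, ha⟩ := hp
    obtain ⟨b, hb⟩ := hq
    refine ⟨a + b, fun i f => ?_⟩
    rw [map_add, MulOpposite.unop_add, map_add, LinearMap.add_apply, ha, hb, ← Pi.single_add,
      add_mul]
  | mul_X p w hp =>
    obtain ⟨a, ha⟩ := hp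
    refine ⟨y w * a, fun i f => ?_⟩
    rw [map_mul, MulOpposite.unop_mul, map_mul, Module.End.mul_apply, refl_y,
      MulOpposite.unop_op, polyRep_y, polyGen_y, ha, mul_assoc]

/-- A nonzero functional of bounded degree on the summand of `i` generates a submodule that
contains `ev i`: if `D + 1` is the least order killed by the functional and `g` has order `D` and is
not killed, then `g(y)` maps the functional to a nonzero multiple of `ev i`. -/
theorem exists_smul_eq_ev {i : Seq v} {φ : DualPoly v} (hφ : e i • φ ≠ 0)
    (hb : ∃ D, ∀ F ∈ order v D, pair φ F = 0) : ∃ a : Alg v, a • φ = ev i := by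
  classical
  have hb' : ∃ D, ∀ f ∈ augIdeal (numStrands v) ^ D, pair φ (single i f) = 0 := by
    obtain ⟨D, hD⟩ := hb
    refine ⟨D, fun f hf => hD _ fun j => ?_⟩
    by_cases h : j = i
    · subst h
      simpa using hf
    · simp [h]
  obtain ⟨D, hD⟩ : ∃ D, Nat.find hb' = D + 1 := by
    refine Nat.exists_eq_succ_of_ne_zero fun h0 => hφ (pair_injective fun j f => ?_)
    have := Nat.find_spec hb'
    rw [h0] at this
    rw [pair_e_smul, this _ (by simp), pair_zero]
  have hs := Nat.find_spec hb'
  have hm := Nat.find_min hb' (m := D) (by omega)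
  rw [hD] at hs
  push Not at hm
  obtain ⟨g, hg, hg0⟩ := hm
  obtain ⟨a, ha⟩ := exists_polyRep_eq_mul (v := v) g
  refine ⟨algebraMap ℂ _ (pair φ (single i g))⁻¹ * (a * e i), pair_injective fun j f => ?_⟩
  rw [mul_smul, pair_algebraMap_smul, mul_smul, pair_smul, ha, pair_e_smul, pair_ev]
  by_cases h : i = j
  · subst h
    simp only [Pi.single_eq_same]
    have h1 : g * f = constantCoeff f • g + g * (f - C (constantCoeff f)) := by
      rw [smul_eq_C_mul]; ring
    have h2 : pair φ (single i (g * (f - C (constantCoeff f)))) = 0 := by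
      refine hs _ ?_
      rw [pow_succ]
      exact Ideal.mul_mem_mul hg (by simp [RingHom.mem_ker])
    have h3 : pair φ (single i (g * f)) = constantCoeff f * pair φ (single i g) := by
      have h4 : single i (g * f) =
          constantCoeff f • single i g + single i (g * (f - C (constantCoeff f))) := by
        rw [← Pi.single_smul, ← Pi.single_add, ← h1]
      rw [h4, map_add, h2, map_smul, add_zero, smul_eq_mul]
    rw [h3]
    field_simp
  · simp [h]

/-! ### The canonical modules -/

/-- A submodule of a canonical cover that meets the weight space of `j` contains `ev j`. -/
theorem ev_mem_of_e_smul_ne_zero {i j : Seq v} {φ : DualPoly v} (hφ : φ ∈ NPrime i)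
    (h : e j • φ ≠ 0) : ev j ∈ Submodule.span (Alg v) {φ} :=
  Submodule.mem_span_singleton.2 (exists_smul_eq_ev h (exists_pair_eq_zero_of_mem_NPrime hφ))

/-- The generator of `N'(i)`. -/
def gen (i : Seq v) : NPrime i := ⟨ev i, ev_mem_NPrime i⟩

theorem eq_top_of_gen_mem {i : Seq v} {M : Submodule (Alg v) (NPrime i)} (h : gen i ∈ M) :
    M = ⊤ := by
  refine eq_top_iff.2 fun x _ => ?_
  obtain ⟨a, ha⟩ := mem_NPrime.1 x.2
  have : x = a • gen i := Subtype.ext ha.symm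
  rw [this]
  exact M.smul_mem a h

/-- The submodule of `N'(i)` of all functionals that vanish on the submodule of the polynomial
representation generated by `1 e(i)`. -/
def maxSub (i : Seq v) : Submodule (Alg v) (NPrime i) where
  carrier := {x | ∀ a : Alg v, pair (a • x.1) (single i 1) = 0}
  zero_mem' a := by simp [pair_zero]
  add_mem' {x z} hx hz a := by
    simp only [Submodule.coe_add, smul_add, pair_add]
    rw [hx a, hz a, add_zero]
  smul_mem' b x hx a := by
    rw [Submodule.coe_smul, ← mul_smul]
    exact hx (a * b)

theorem gen_notMem_maxSub (i : Seq v) : gen i ∉ maxSub i := by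
  intro h
  have := h 1
  rw [one_smul] at this
  simp [gen, pair_ev] at this

theorem maxSub_ne_top (i : Seq v) : maxSub i ≠ ⊤ := fun h =>
  gen_notMem_maxSub i (h ▸ Submodule.mem_top)

theorem le_maxSub {i : Seq v} {M : Submodule (Alg v) (NPrime i)} (hM : M ≠ ⊤) :
    M ≤ maxSub i := by
  intro x hx a
  by_contra h
  refine hM (eq_top_of_gen_mem ?_)
  have hne : e i • (a • x.1) ≠ 0 := by
    intro h0
    apply h
    have := pair_e_smul i (a • x.1) (single i 1)
    rw [h0, pair_zero, single_self] at this
    exact this.symm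
  obtain ⟨b, hb⟩ := Submodule.mem_span_singleton.1
    (ev_mem_of_e_smul_ne_zero ((NPrime i).smul_mem a x.2) hne)
  have : gen i = b • a • x := Subtype.ext hb.symm
  rw [this]
  exact M.smul_mem b (M.smul_mem a hx)

theorem existsUnique_isCoatom (i : Seq v) :
    ∃! M : Submodule (Alg v) (NPrime i), IsCoatom M := by
  refine ⟨maxSub i, ⟨maxSub_ne_top i, fun M hM => ?_⟩, fun M hM => ?_⟩
  · by_contra h
    exact absurd (le_maxSub h) hM.not_ge
  · by_contra h
    exact maxSub_ne_top i (hM.2 _ (lt_of_le_of_ne (le_maxSub hM.1) h))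

theorem jacobson_ne_top (i : Seq v) : Module.jacobson (Alg v) (NPrime i) ≠ ⊤ := by
  obtain ⟨M, hM, -⟩ := existsUnique_isCoatom i
  intro h
  have h1 : Module.jacobson (Alg v) (NPrime i) ≤ M := sInf_le hM
  exact hM.1 (top_le_iff.1 (h ▸ h1))

/-- An isomorphism of canonical modules moves the generator `ev i` of the first into the weight
space of `i` in the second, so this weight space is not zero. -/
theorem ev_mem_NPrime_of_equiv {i j : Seq v} (θ : N i ≃ₗ[Alg v] N j) : ev i ∈ NPrime j := by
  set J := Module.jacobson (Alg v) (NPrime i) with hJ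
  set J' := Module.jacobson (Alg v) (NPrime j) with hJ'
  have hne : J.mkQ (gen i) ≠ 0 := by
    intro h
    rw [Submodule.mkQ_apply, Submodule.Quotient.mk_eq_zero] at h
    exact jacobson_ne_top i (eq_top_of_gen_mem h)
  have he : e i • gen i = gen i := Subtype.ext (e_smul_ev i)
  obtain ⟨φ, hφ⟩ := J'.mkQ_surjective (θ (J.mkQ (gen i)))
  have hu : e i • θ (J.mkQ (gen i)) = θ (J.mkQ (gen i)) := by
    rw [← map_smul, ← map_smul, he]
  have h0 : e i • φ.1 ≠ 0 := by
    intro h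
    apply hne
    apply θ.injective
    have : e i • φ = 0 := Subtype.ext h
    rw [map_zero, ← hu, ← hφ, ← map_smul, this, map_zero]
  exact (Submodule.span_singleton_le_iff_mem _ _).2 φ.2 (ev_mem_of_e_smul_ne_zero φ.2 h0)

/-! ### Invariance under the moves -/

theorem constantCoeff_divDiff {V : ℕ} (x z : Fin V) (h : x ≠ z) (f : MvPolynomial (Fin V) ℂ) :
    constantCoeff (divDiff x z h f) =
      constantCoeff (pderiv x f) - constantCoeff (pderiv z f) := by
  have h1 := congrArg (fun q => constantCoeff (pderiv x q)) (divDiff_spec x z h f)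
  have h2 : pderiv x (tr x z f) = tr x z (pderiv z f) := by
    have := pderiv_rename (R := ℂ) (Equiv.swap x z).injective z f
    rwa [Equiv.swap_apply_right] at this
  simp only [Derivation.leibniz, map_add, map_sub, map_mul, smul_eq_mul, constantCoeff_X, sub_zero,
    pderiv_X_self, pderiv_X_of_ne h.symm, h2, constantCoeff_rename, zero_mul, zero_sub, mul_neg,
    mul_one, map_neg] at h1
  linear_combination -h1

theorem Seq.swap_letter_lo (k : Pos (numStrands v)) (i : Seq v) :
    (Seq.swap k i).letter k.lo = i.letter k.hi := by
  simp [Seq.letter]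

theorem Seq.swap_letter_hi (k : Pos (numStrands v)) (i : Seq v) :
    (Seq.swap k i).letter k.hi = i.letter k.lo := by
  simp [Seq.letter]

theorem not_isSucc_self (a : Fin n) : ¬ IsSucc a a := by simp [IsSucc]

theorem not_isSucc_of_isSucc {a b : Fin n} (h : IsSucc a b) : ¬ IsSucc b a := by
  simp only [IsSucc] at *; omega

theorem ev_mem_NPrime_swap (k : Pos (numStrands v)) (i : Seq v)
    (hne : i.letter k.lo ≠ i.letter k.hi) (hs : ¬ IsSucc (i.letter k.lo) (i.letter k.hi)) :
    ev i ∈ NPrime (Seq.swap k i) := by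
  refine mem_NPrime.2 ⟨psi k, pair_injective fun j f => ?_⟩
  rw [pair_smul, refl_psi, MulOpposite.unop_op, polyRep_psi, polyGen_psi, pair_ev, pair_ev]
  by_cases h : j = i
  · subst h
    rw [single_self, single_self, crossOp_ne k hne, twist, if_neg hs, one_mul,
      constantCoeff_rename]
  · have h' : Seq.swap k j ≠ Seq.swap k i := fun hh => h (by
      rw [← Seq.swap_swap k j, hh, Seq.swap_swap])
    rw [single_of_ne h'.symm, single_of_ne (Ne.symm h)]

theorem ev_swap_mem_NPrime (k : Pos (numStrands v)) (i : Seq v)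
    (hne : i.letter k.lo ≠ i.letter k.hi) (hs : ¬ IsSucc (i.letter k.hi) (i.letter k.lo)) :
    ev (Seq.swap k i) ∈ NPrime i := by
  have := ev_mem_NPrime_swap k (Seq.swap k i)
    (by rw [Seq.swap_letter_lo, Seq.swap_letter_hi]; exact hne.symm)
    (by rwa [Seq.swap_letter_lo, Seq.swap_letter_hi])
  rwa [Seq.swap_swap] at this

/-- The crossing of strands labelled `r`, `r + 1` maps `1` to a difference of two variables.  If one
of the two strands is next to a strand of the same black label after the crossing, then the divided
difference for these two strands maps that difference to a nonzero constant. -/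
theorem ev_mem_NPrime_swap_of_isSucc (k l : Pos (numStrands v)) (i : Seq v)
    (hkl : (l.lo = k.hi ∧ l.hi ≠ k.lo) ∨ (l.hi = k.lo ∧ l.lo ≠ k.hi))
    (hs : IsSucc (i.letter k.lo) (i.letter k.hi))
    (he : (Seq.swap k i).letter l.lo = (Seq.swap k i).letter l.hi)
    (hr : ¬ IsRed ((Seq.swap k i).letter l.lo)) :
    ev i ∈ NPrime (Seq.swap k i) := by
  have hne : i.letter k.lo ≠ i.letter k.hi := by
    intro hh
    rw [hh] at hs
    exact not_isSucc_self _ hs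
  have hj : Seq.swap l (Seq.swap k i) = Seq.swap k i := Seq.swap_eq_self _ _ he
  have hcoeff : ∀ g : MvPolynomial (Fin (numStrands v)) ℂ,
      constantCoeff (divDiff l.lo l.hi l.lo_ne_hi ((X k.lo - X k.hi) * g)) =
        -constantCoeff g := by
    intro g
    have h1 := l.lo_ne_hi
    have h2 := k.lo_ne_hi
    rw [constantCoeff_divDiff]
    simp only [Derivation.leibniz, map_add, map_sub, map_mul, smul_eq_mul, constantCoeff_X,
      sub_zero, pderiv_X, Pi.single_apply, zero_mul, zero_add, mul_sub]
    rcases hkl with ⟨h3, h4⟩ | ⟨h3, h4⟩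
    · rw [h3] at h1 ⊢
      simp [h1, h2, h4.symm]
    · rw [h3] at h1 ⊢
      simp [h1.symm, h2.symm, h4.symm]
  refine mem_NPrime.2 ⟨algebraMap ℂ _ (-1) * (psi k * psi l), pair_injective fun j f => ?_⟩
  rw [mul_smul, pair_algebraMap_smul, pair_smul, map_mul, MulOpposite.unop_mul, map_mul,
    Module.End.mul_apply, refl_psi, refl_psi, MulOpposite.unop_op, MulOpposite.unop_op,
    polyRep_psi, polyRep_psi, polyGen_psi, polyGen_psi, pair_ev, pair_ev]
  by_cases h : j = i
  · subst h
    rw [hj, single_self, single_self, ← he, crossOp_ne k hne, twist, if_pos hs]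
    simp only [crossOp, if_true, if_neg hr]
    rw [hcoeff, constantCoeff_rename]
    ring
  · have h' : Seq.swap l (Seq.swap k j) ≠ Seq.swap k i := fun hh => h (by
      rw [← Seq.swap_swap k j, ← Seq.swap_swap l (Seq.swap k j), hh, hj, Seq.swap_swap])
    rw [single_of_ne h'.symm, single_of_ne (Ne.symm h)]
    simp

theorem NPrime_eq_of_mem {i j : Seq v} (h1 : ev i ∈ NPrime j) (h2 : ev j ∈ NPrime i) :
    NPrime i = NPrime j :=
  le_antisymm ((Submodule.span_singleton_le_iff_mem _ _).2 h1)
    ((Submodule.span_singleton_le_iff_mem _ _).2 h2)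

/-- The moves do not change the submodule `N'(i)` of the dual of the polynomial representation. -/
theorem Move.NPrime_eq {i j : Seq v} (h : Move i j) : NPrime i = NPrime j := by
  cases h with
  | far k i h1 h2 =>
    by_cases h : i.letter k.lo = i.letter k.hi
    · rw [Seq.swap_eq_self k i h]
    · exact NPrime_eq_of_mem (ev_mem_NPrime_swap k i h h1) (ev_swap_mem_NPrime k i h h2)
  | down k l hkl i h hr h1 =>
    have hl : l.lo = k.hi := Fin.ext hkl
    have h2 := k.lo_ne_hi
    have h3 : k.lo ≠ l.hi := by simp only [Pos.lo, Pos.hi, ne_eq, Fin.mk.injEq]; omega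
    have hs : IsSucc (i.letter l.lo) (i.letter l.hi) := by rw [hl, ← h]; exact h1
    have hw : (Seq.swap l i).letter k.lo = i.letter k.lo := by
      simp only [Seq.letter, Seq.swap_letter, Pos.s]
      rw [Equiv.swap_apply_of_ne_of_ne (by rw [hl]; exact h2) h3]
    have hw' : (Seq.swap l i).letter k.hi = i.letter l.hi := by
      simp only [Seq.letter, Seq.swap_letter, Pos.s, ← hl, Equiv.swap_apply_left]
    refine NPrime_eq_of_mem (ev_mem_NPrime_swap_of_isSucc l k i (Or.inr ⟨hl.symm, h3⟩) hs
      (by rw [hw, hw', h]) (by rwa [hw]))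
      (ev_swap_mem_NPrime l i (fun hh => ?_) (not_isSucc_of_isSucc hs))
    rw [hh] at hs
    exact not_isSucc_self _ hs
  | up k l hkl i h hr h1 =>
    have hl : l.lo = k.hi := Fin.ext hkl
    have h2 := l.lo_ne_hi
    have h3 : l.hi ≠ k.lo := by simp only [Pos.lo, Pos.hi, ne_eq, Fin.mk.injEq]; omega
    have hw : (Seq.swap k i).letter l.lo = i.letter k.lo := by
      simp only [Seq.letter, Seq.swap_letter, Pos.s, hl, Equiv.swap_apply_right]
    have hw' : (Seq.swap k i).letter l.hi = i.letter l.hi := by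
      simp only [Seq.letter, Seq.swap_letter, Pos.s]
      rw [Equiv.swap_apply_of_ne_of_ne h3 (by rw [← hl]; exact h2.symm)]
    refine NPrime_eq_of_mem (ev_mem_NPrime_swap_of_isSucc k l i (Or.inl ⟨hl, h3⟩) h1
      (by rw [hw, hw', h]) (by rwa [hw]))
      (ev_swap_mem_NPrime k i (fun hh => ?_) (not_isSucc_of_isSucc h1))
    rw [hh] at h1
    exact not_isSucc_self _ h1

theorem NPrime_eq_of_eqvGen {i j : Seq v} (h : Relation.EqvGen Move i j) :
    NPrime i = NPrime j := by
  induction h with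
  | rel _ _ h => exact h.NPrime_eq
  | refl => rfl
  | symm _ _ _ ih => exact ih.symm
  | trans _ _ _ _ _ ih1 ih2 => exact ih1.trans ih2


/-! ### Shuffles of segments -/

/-- A list `y` of pairs `(a, d)` stands for a multisegment whose `q`th segment is the interval
`[a, a + d]` of labels, labels being counted from `0`.  `Box y q r` says that the label `r` lies in
the `q`th segment. -/
def Box (y : List (ℕ × ℕ)) (q r : ℕ) : Prop :=
  ∃ s, y[q]? = some s ∧ s.1 ≤ r ∧ r ≤ s.1 + s.2

/-- The colouring `c` of its positions presents the word `i` as a shuffle of the segments of `y`,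
each of them read downwards: the letters of colour `q` are those of the `q`th segment, in
decreasing order.  The colours of the red letters have to decrease along the word, that is, the
red segments occur in a fixed order. -/
structure IsShuffle (y : List (ℕ × ℕ)) (i : Seq v) (c : Fin (numStrands v) → ℕ) : Prop where
  box : ∀ p, Box y (c p) (i.1 p)
  surj : ∀ q r, Box y q r → ∃ p, c p = q ∧ (i.1 p : ℕ) = r
  lt : ∀ p p', p < p' → c p = c p' → i.1 p' < i.1 p
  red : ∀ p p', p < p' → IsRed (i.1 p) → IsRed (i.1 p') → c p' < c p

theorem Pos.s_lt_s {V : ℕ} (k : Pos V) {p p' : Fin V} (h : p < p') :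
    k.s p < k.s p' ∨ (p = k.lo ∧ p' = k.hi) := by
  by_cases h1 : p = k.lo ∧ p' = k.hi
  · exact Or.inr h1
  · left
    simp only [Pos.s, Equiv.swap_apply_def]
    simp only [Pos.lo, Pos.hi, Fin.ext_iff, Fin.lt_def] at *
    split_ifs <;> (try dsimp only) <;> omega

/-- Neighbouring strands of different colours may be exchanged, unless both are red. -/
theorem IsShuffle.swap {y : List (ℕ × ℕ)} {i : Seq v} {c : Fin (numStrands v) → ℕ}
    (h : IsShuffle y i c) (k : Pos (numStrands v)) (hc : c k.lo ≠ c k.hi)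
    (hr : ¬ (IsRed (i.1 k.lo) ∧ IsRed (i.1 k.hi))) :
    IsShuffle y (Seq.swap k i) (fun p => c (k.s p)) where
  box p := h.box (k.s p)
  surj q r hq := by
    obtain ⟨p, h1, h2⟩ := h.surj q r hq
    exact ⟨k.s p, by simpa using h1, by simpa using h2⟩
  lt p p' hp hcc := by
    rcases k.s_lt_s hp with h1 | ⟨rfl, rfl⟩
    · exact h.lt _ _ h1 hcc
    · simp only [Equiv.swap_apply_left, Equiv.swap_apply_right] at hcc
      exact absurd hcc.symm hc
  red p p' hp h1 h2 := by
    rcases k.s_lt_s hp with h3 | ⟨rfl, rfl⟩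
    · exact h.red _ _ h3 h1 h2
    · simp only [Seq.swap_letter, Equiv.swap_apply_left, Equiv.swap_apply_right] at h1 h2
      exact absurd ⟨h2, h1⟩ hr

/-- Neighbouring letters of the same colour are neighbours in their segment. -/
theorem IsShuffle.isSucc {y : List (ℕ × ℕ)} {i : Seq v} {c : Fin (numStrands v) → ℕ}
    (h : IsShuffle y i c) (k : Pos (numStrands v)) (hc : c k.lo = c k.hi) :
    IsSucc (i.1 k.hi) (i.1 k.lo) := by
  have hlt : k.lo < k.hi := by simp [Pos.lo, Pos.hi, Fin.lt_def]
  have h1 := h.lt _ _ hlt hc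
  by_contra hne
  obtain ⟨s, hs, h2, h3⟩ := h.box k.lo
  obtain ⟨s', hs', h2', h3'⟩ := h.box k.hi
  rw [← hc, hs, Option.some.injEq] at hs'
  subst hs'
  rw [Fin.lt_def] at h1
  simp only [IsSucc] at hne
  -- A letter strictly between the two would have to sit between the positions `k` and `k + 1`.
  obtain ⟨p, hp, hp'⟩ := h.surj (c k.lo) (i.1 k.hi + 1) ⟨s, hs, by omega, by omega⟩
  have a1 : k.lo < p := by
    by_contra hle
    rcases (not_lt.1 hle).eq_or_lt with rfl | hlt'
    · omega
    · have := h.lt _ _ hlt' hp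
      rw [Fin.lt_def] at this
      omega
  have a2 : p < k.hi := by
    by_contra hle
    rcases (not_lt.1 hle).eq_or_lt with rfl | hlt'
    · omega
    · have := h.lt _ _ hlt' (hc.symm.trans hp.symm)
      rw [Fin.lt_def] at this
      omega
  simp only [Pos.lo, Pos.hi, Fin.lt_def] at a1 a2
  omega

/-- The elements of the polynomial representation that vanish at all points with coordinates
`t * c p`, for the shuffles `(i, c)` of the segments of `y` and `t ≠ 0`. -/
def vanishing (v : Fin n → ℕ) (y : List (ℕ × ℕ)) : Submodule ℂ (Poly v) where
  carrier := {F | ∀ i c, IsShuffle y i c → ∀ t : ℂ, t ≠ 0 → eval (fun p => t * c p) (F i) = 0}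
  zero_mem' i c _ t _ := by simp
  add_mem' {F G} hF hG i c h t ht := by simp [hF i c h t ht, hG i c h t ht]
  smul_mem' r F hF i c h t ht := by simp [smul_eval, hF i c h t ht]

theorem eval_tr {V : ℕ} (x z : Fin V) (g : Fin V → ℂ) (f : MvPolynomial (Fin V) ℂ) :
    eval g (tr x z f) = eval (fun p => g (Equiv.swap x z p)) f := by
  rw [eval_rename]
  rfl

theorem polyGen_y_apply (k) (F : Poly v) (j : Seq v) : polyGen (.y k) F j = X k * F j := rfl

theorem polyGen_psi_apply (k) (F : Poly v) (j : Seq v) :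
    polyGen (.psi k) F j = crossOp k ((Seq.swap k j).letter k.lo) ((Seq.swap k j).letter k.hi)
      (F (Seq.swap k j)) := rfl

theorem polyGen_mem_vanishing (y : List (ℕ × ℕ)) (g : Gen v) {F : Poly v}
    (hF : F ∈ vanishing v y) : polyGen g F ∈ vanishing v y := by
  intro j c h t ht
  cases g with
  | e i =>
    rw [polyGen_e]
    by_cases hij : j = i
    · subst hij
      rw [single_self]
      exact hF j c h t ht
    · rw [single_of_ne hij, map_zero]
  | y k =>
    rw [polyGen_y_apply, map_mul, hF j c h t ht, mul_zero]
  | psi k =>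
    rw [polyGen_psi_apply, Seq.swap_letter_lo, Seq.swap_letter_hi]
    by_cases hab : j.letter k.hi = j.letter k.lo
    · have hc : c k.lo ≠ c k.hi := by
        intro hc
        have := h.isSucc k hc
        simp only [Seq.letter] at hab
        rw [hab] at this
        exact not_isSucc_self _ this
      rw [← hab]
      by_cases hr : IsRed (j.letter k.hi)
      · rw [crossOp_red k hr, map_zero]
      · have h1 := h.swap k hc (fun hh => hr hh.2)
        have h2 := congrArg (eval fun p => t * (c p : ℂ)) (crossOp_eq k hr (F (Seq.swap k j)))
        have h3 := hF _ _ h1 t ht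
        have h4 : eval (fun p => t * (c p : ℂ)) (F (Seq.swap k j)) = 0 := by
          rw [Seq.swap_eq_self k j hab.symm]
          exact hF j c h t ht
        rw [map_mul, map_sub, map_sub, eval_X, eval_X, eval_tr, h3, h4, sub_zero, ← mul_sub] at h2
        refine (mul_eq_zero.1 h2).resolve_left (mul_ne_zero ht (sub_ne_zero.2 ?_))
        exact_mod_cast hc.symm
    · rw [crossOp_ne k hab, map_mul, eval_tr]
      by_cases hc : c k.lo = c k.hi
      · rw [twist, if_pos (h.isSucc k hc), map_sub, eval_X, eval_X, hc, sub_self, zero_mul]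
      · have h1 := h.swap k hc (fun hh => hab (by
          apply Fin.ext
          simp only [IsRed] at hh
          simp only [Seq.letter]
          omega))
        rw [hF _ _ h1 t ht, mul_zero]

theorem constantCoeff_eq_zero_of_eval {V : ℕ} (f : MvPolynomial (Fin V) ℂ) (c : Fin V → ℂ)
    (h : ∀ t : ℂ, t ≠ 0 → eval (fun p => t * c p) f = 0) : constantCoeff f = 0 := by
  have hcont : Continuous fun t : ℂ => eval (fun p => t * c p) f :=
    (MvPolynomial.continuous_eval f).comp (by fun_prop)
  have := congrFun (hcont.ext_on (dense_compl_singleton (0 : ℂ)) continuous_const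
    (fun t ht => h t ht)) 0
  simpa [← constantCoeff_eq, eval_zero'] using this

/-- If `ev i` lies in `N'(j)`, then `i` is a shuffle of every multisegment that `j` is a
shuffle of: otherwise `1 e(i)` and hence all it generates would vanish at the corresponding
points, contrary to `ev i` being obtained from the value of its image at the origin. -/
theorem exists_isShuffle_of_ev_mem {i j : Seq v} (h : ev i ∈ NPrime j) {y : List (ℕ × ℕ)}
    (hj : ∃ c, IsShuffle y j c) : ∃ c, IsShuffle y i c := by
  by_contra hi
  obtain ⟨c, hc⟩ := hj
  obtain ⟨a, ha⟩ := mem_NPrime.1 h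
  have h1 : single i 1 ∈ vanishing v y := by
    intro l c' h' t ht
    have : l ≠ i := fun hl => hi ⟨c', hl ▸ h'⟩
    rw [single_of_ne this, map_zero]
  have h2 := polyRep_mem_of_stable (vanishing v y) (fun g F hF => polyGen_mem_vanishing y g hF)
    (refl v a).unop _ h1
  have h3 := constantCoeff_eq_zero_of_eval _ _ (h2 j c hc)
  rw [← pair_ev, ← pair_smul, ha, pair_ev, single_self] at h3
  simp at h3


/-! ### Rewriting words by moves -/

/-- The letters of a word, as a list of natural numbers. -/
def toList (i : Seq v) : List ℕ := List.ofFn fun p => (i.1 p : ℕ)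

theorem toList_injective : Function.Injective (toList (v := v)) := by
  intro i j h
  apply Subtype.ext
  funext p
  exact Fin.ext (congrFun (List.ofFn_injective h) p)

theorem length_toList (i : Seq v) : (toList i).length = numStrands v := by simp [toList]

theorem getElem?_toList (i : Seq v) (p : Fin (numStrands v)) :
    (toList i)[(p : ℕ)]? = some (i.1 p : ℕ) := by
  simp [toList]

theorem toList_swap {i : Seq v} {A B : List ℕ} {x z : ℕ} (h : toList i = A ++ x :: z :: B) :
    ∃ k : Pos (numStrands v), k.1 = A.length ∧
      toList (Seq.swap k i) = A ++ z :: x :: B := by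
  have hlen := length_toList i
  rw [h] at hlen
  simp only [List.length_append, List.length_cons] at hlen
  let k : Pos (numStrands v) := ⟨A.length, by omega⟩
  refine ⟨k, rfl, ?_⟩
  have hg := getElem?_toList i
  rw [h] at hg
  refine List.ext_getElem? fun p => ?_
  by_cases hp : p < numStrands v
  · have h1 := getElem?_toList (Seq.swap k i) ⟨p, hp⟩
    have h2 := hg (k.s ⟨p, hp⟩)
    rw [Seq.swap_letter] at h1
    simp only at h1
    rw [h1, ← h2]
    simp only [Pos.s, Equiv.swap_apply_def, Pos.lo, Pos.hi, Fin.ext_iff, k]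
    grind
  · rw [List.getElem?_eq_none (by rw [length_toList]; omega),
      List.getElem?_eq_none (by simp only [List.length_append, List.length_cons]; omega)]

variable (v) in
/-- In every word with letter multiplicities `v`, a block of letters `l` can be replaced by
the block `l'` by means of moves. -/
def Reach (l l' : List ℕ) : Prop :=
  ∀ A B (i : Seq v), toList i = A ++ l ++ B →
    ∃ j, Relation.EqvGen Move i j ∧ toList j = A ++ l' ++ B

theorem Reach.refl (l : List ℕ) : Reach v l l := fun _ _ i h => ⟨i, .refl i, h⟩

theorem Reach.trans {l₁ l₂ l₃ : List ℕ} (h1 : Reach v l₁ l₂) (h2 : Reach v l₂ l₃) :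
    Reach v l₁ l₃ := by
  intro A B i h
  obtain ⟨j, hj, hj'⟩ := h1 A B i h
  obtain ⟨k, hk, hk'⟩ := h2 A B j hj'
  exact ⟨k, hj.trans _ _ _ hk, hk'⟩

theorem Reach.append {l l' : List ℕ} (h : Reach v l l') (C D : List ℕ) :
    Reach v (C ++ l ++ D) (C ++ l' ++ D) := by
  intro A B i hi
  obtain ⟨j, hj, hj'⟩ := h (A ++ C) (D ++ B) i (by simpa [List.append_assoc] using hi)
  exact ⟨j, hj, by simpa [List.append_assoc] using hj'⟩

theorem Reach.append_left {l l' : List ℕ} (h : Reach v l l') (C : List ℕ) :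
    Reach v (C ++ l) (C ++ l') := by
  simpa using h.append C []

theorem Reach.append_right {l l' : List ℕ} (h : Reach v l l') (D : List ℕ) :
    Reach v (l ++ D) (l' ++ D) := by
  simpa using h.append [] D

theorem Reach.cons {l l' : List ℕ} (h : Reach v l l') (x : ℕ) : Reach v (x :: l) (x :: l') :=
  h.append_left [x]

theorem letter_eq_of_getElem? {i : Seq v} {l : List ℕ} (h : toList i = l)
    (p : Fin (numStrands v)) {x : ℕ} (hx : l[(p : ℕ)]? = some x) : (i.1 p : ℕ) = x := by
  have := getElem?_toList i p
  rw [h, hx] at this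
  exact (Option.some.inj this).symm

theorem getElem?_length_add_two (A : List ℕ) (x z w : ℕ) (B : List ℕ) :
    (A ++ x :: z :: w :: B)[A.length + 1 + 1]? = some w := by
  rw [List.getElem?_append_right (by omega), show A.length + 1 + 1 - A.length = 2 by omega]
  rfl

theorem Reach.far {r s : ℕ} (h1 : r + 1 ≠ s) (h2 : s + 1 ≠ r) : Reach v [r, s] [s, r] := by
  intro A B i h
  obtain ⟨k, hk, hk'⟩ := toList_swap (A := A) (B := B) (x := r) (z := s) (by simpa using h)
  have g1 : (i.1 k.lo : ℕ) = r := letter_eq_of_getElem? h _ (by simp [Pos.lo, hk])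
  have g2 : (i.1 k.hi : ℕ) = s := letter_eq_of_getElem? h _ (by simp [Pos.hi, hk])
  exact ⟨_, .rel _ _ (Move.far k i (by simp only [IsSucc, Seq.letter]; omega)
    (by simp only [IsSucc, Seq.letter]; omega)), by simpa using hk'⟩

theorem Reach.down {c : ℕ} (hc : c + 1 + 1 ≠ n) :
    Reach v [c + 1, c, c + 1] [c + 1, c + 1, c] := by
  intro A B i h
  obtain ⟨l, hl, hl'⟩ := toList_swap (A := A ++ [c + 1]) (B := B) (x := c) (z := c + 1)
    (by simpa using h)
  simp only [List.length_append, List.length_cons, List.length_nil, zero_add] at hl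
  let k : Pos (numStrands v) := ⟨A.length, by have := l.2; omega⟩
  have g1 : (i.1 k.lo : ℕ) = c + 1 := letter_eq_of_getElem? h _ (by simp [Pos.lo, k])
  have g2 : (i.1 k.hi : ℕ) = c := letter_eq_of_getElem? h _ (by simp [Pos.hi, k])
  have g3 : (i.1 l.hi : ℕ) = c + 1 :=
    letter_eq_of_getElem? h _
      (by simpa [Pos.hi, hl] using getElem?_length_add_two A (c + 1) c (c + 1) B)
  exact ⟨_, .rel _ _ (Move.down k l hl i (Fin.ext (g1.trans g3.symm))
    (by simp only [IsRed, Seq.letter]; omega) (by simp only [IsSucc, Seq.letter]; omega)),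
    by simpa using hl'⟩

theorem Reach.up {c : ℕ} : Reach v [c + 1, c, c] [c, c + 1, c] := by
  intro A B i h
  obtain ⟨k, hk, hk'⟩ := toList_swap (A := A) (B := c :: B) (x := c + 1) (z := c)
    (by simpa using h)
  have hlen := length_toList i
  rw [h] at hlen
  simp only [List.length_append, List.length_cons, List.length_nil] at hlen
  let l : Pos (numStrands v) := ⟨A.length + 1, by omega⟩
  have hlk : l.1 = k.1 + 1 := by rw [hk]
  set j := Seq.swap k i with hj
  have g1 : (j.1 k.lo : ℕ) = c := letter_eq_of_getElem? hk' _ (by simp [Pos.lo, hk])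
  have g2 : (j.1 k.hi : ℕ) = c + 1 := letter_eq_of_getElem? hk' _ (by simp [Pos.hi, hk])
  have g3 : (j.1 l.hi : ℕ) = c :=
    letter_eq_of_getElem? hk' _ (by simpa [Pos.hi, l] using getElem?_length_add_two A c (c + 1) c B)
  have hm := Move.up k l hlk j (Fin.ext (g1.trans g3.symm))
    (by simp only [IsRed, Seq.letter]; omega) (by simp only [IsSucc, Seq.letter]; omega)
  rw [hj, Seq.swap_swap, ← hj] at hm
  exact ⟨j, .symm _ _ (.rel _ _ hm), by simpa using hk'⟩

theorem Reach.far_list {c : ℕ} {l : List ℕ} (h : ∀ x ∈ l, x + 1 ≠ c ∧ c + 1 ≠ x) :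
    Reach v (l ++ [c]) (c :: l) := by
  induction l with
  | nil => exact Reach.refl _
  | cons x l ih =>
    have h1 : Reach v (x :: (l ++ [c])) (x :: c :: l) :=
      (ih fun z hz => h z (List.mem_cons_of_mem _ hz)).cons x
    have hx := h x List.mem_cons_self
    exact h1.trans ((Reach.far hx.1 hx.2).append_right l)

/-! ### Normal forms of words -/

/-- The word `a + d, a + d - 1, …, a` of the segment `[a, a + d]`. -/
def seg (a : ℕ) : ℕ → List ℕ
  | 0 => [a]
  | d + 1 => (a + d + 1) :: seg a d

theorem mem_seg {a d r : ℕ} : r ∈ seg a d ↔ a ≤ r ∧ r ≤ a + d := by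
  induction d with
  | zero => simp only [seg, List.mem_singleton]; omega
  | succ d ih => simp only [seg, List.mem_cons, ih]; omega

theorem seg_pairwise (a d : ℕ) : (seg a d).Pairwise (· > ·) := by
  induction d with
  | zero => simp [seg]
  | succ d ih =>
    refine List.pairwise_cons.2 ⟨fun r hr => ?_, ih⟩
    rw [mem_seg] at hr
    omega

theorem seg_append (c d : ℕ) : seg (c + 1) d ++ [c] = seg c (d + 1) := by
  induction d with
  | zero => simp [seg]
  | succ d ih =>
    rw [seg, List.cons_append, ih, seg.eq_2 c (d + 1)]
    congr 1
    omega

theorem exists_seg_eq_cons (a d : ℕ) :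
    ∃ l, seg a d = (a + d) :: l ∧ ∀ x ∈ l, x < a + d := by
  have := seg_pairwise a d
  cases d with
  | zero => exact ⟨[], rfl, by simp⟩
  | succ d =>
    rw [seg, List.pairwise_cons] at this
    exact ⟨_, rfl, this.1⟩

/-- A black letter commutes with every segment that contains it.  Coming from
the right, `c` passes `c - 1` by the second kind of move, with its copy in the segment to the left
of `c - 1`; then the two letters `c` pass to one copy on each side of `c + 1` by the third kind.  It
commutes with all other letters. -/
theorem Reach.seg_comm {a c : ℕ} (hc : c + 1 ≠ n) (d : ℕ) (h1 : a ≤ c) (h2 : c ≤ a + d) :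
    Reach v (seg a d ++ [c]) (c :: seg a d) := by
  induction d with
  | zero =>
    obtain rfl : c = a := by omega
    exact Reach.refl _
  | succ d ih =>
    obtain ⟨l, hl, hl'⟩ := exists_seg_eq_cons a d
    rw [seg, List.cons_append]
    by_cases h : c ≤ a + d
    · refine ((ih h).cons _).trans ?_
      by_cases h3 : c = a + d
      · subst h3
        rw [hl]
        exact Reach.up.append_right l
      · exact (Reach.far (by omega) (by omega)).append_right (seg a d)
    · obtain rfl : c = a + d + 1 := by omega
      rw [hl]
      have h3 : Reach v (l ++ [a + d + 1]) ((a + d + 1) :: l) :=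
        Reach.far_list fun x hx => by have := hl' x hx; omega
      exact (h3.append_left [a + d + 1, a + d]).trans ((Reach.down hc).append_right l)

/-- The word of a list of segments.  The segments are read downwards and the list from its end to
its head. -/
def word : List (ℕ × ℕ) → List ℕ
  | [] => []
  | s :: y => word y ++ seg s.1 s.2

/-- Appending the black letter `c` to the word of a list of segments: `c` travels to the left until
it extends a segment, or until it meets the segments that lie below it. -/
def ins (c : ℕ) : List (ℕ × ℕ) → List (ℕ × ℕ)
  | [] => [(c, 0)]
  | s :: y => if s.1 = c + 1 then (c, s.2 + 1) :: y
      else if s.1 + s.2 < c then (c, 0) :: s :: y else s :: ins c y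

theorem reach_ins {c : ℕ} (hc : c + 1 ≠ n) (y : List (ℕ × ℕ)) :
    Reach v (word y ++ [c]) (word (ins c y)) := by
  induction y with
  | nil => exact Reach.refl _
  | cons s y ih =>
    rw [ins, word, List.append_assoc]
    split_ifs with h1 h2
    · rw [word, h1, seg_append]
      exact Reach.refl _
    · rw [word, word, List.append_assoc]
      exact Reach.refl _
    · have h3 : Reach v (seg s.1 s.2 ++ [c]) (c :: seg s.1 s.2) := by
        by_cases h4 : s.1 ≤ c
        · exact Reach.seg_comm hc _ h4 (by omega)
        · refine Reach.far_list fun x hx => ?_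
          rw [mem_seg] at hx
          omega
      refine (h3.append_left (word y)).trans ?_
      rw [word]
      simpa using ih.append_right (seg s.1 s.2)

/-- The order of the segments in a normal form: the upper ends decrease weakly, and among the
black segments with the same upper end the lower ends increase weakly.  There is no condition on
the lower ends of the red segments. -/
def SegLE (n : ℕ) (s t : ℕ × ℕ) : Prop :=
  t.1 + t.2 < s.1 + s.2 ∨ (s.1 + s.2 = t.1 + t.2 ∧ (s.1 + s.2 + 1 = n ∨ s.1 ≤ t.1))

/-- A list of segments in normal form. -/
structure IsNormal (n : ℕ) (y : List (ℕ × ℕ)) : Prop where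
  sorted : y.Pairwise (SegLE n)
  lt : ∀ s ∈ y, s.1 + s.2 < n

theorem mem_ins {c : ℕ} {y : List (ℕ × ℕ)} {t : ℕ × ℕ} (h : t ∈ ins c y) :
    t ∈ y ∨ t = (c, 0) ∨ ∃ d, (c + 1, d) ∈ y ∧ t = (c, d + 1) := by
  induction y with
  | nil => simp_all [ins]
  | cons s y ih =>
    rw [ins] at h
    split_ifs at h with h1 h2
    · rcases List.mem_cons.1 h with h | h
      · exact Or.inr (Or.inr ⟨s.2, by rw [← h1]; simp, h⟩)
      · exact Or.inl (List.mem_cons_of_mem _ h)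
    · rcases List.mem_cons.1 h with h | h
      · exact Or.inr (Or.inl h)
      · exact Or.inl h
    · rcases List.mem_cons.1 h with h | h
      · exact Or.inl (h ▸ List.mem_cons_self)
      · rcases ih h with h | h | ⟨d, h, h'⟩
        · exact Or.inl (List.mem_cons_of_mem _ h)
        · exact Or.inr (Or.inl h)
        · exact Or.inr (Or.inr ⟨d, List.mem_cons_of_mem _ h, h'⟩)

theorem IsNormal.ins {c : ℕ} (hc : c + 1 < n) {y : List (ℕ × ℕ)} (h : IsNormal n y) :
    IsNormal n (ins c y) where
  sorted := by
    have hs := h.sorted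
    clear h
    induction y with
    | nil => simp [KLRW.ins]
    | cons s y ih =>
      rw [List.pairwise_cons] at hs
      rw [KLRW.ins]
      split_ifs with h1 h2
      · refine List.pairwise_cons.2 ⟨fun t ht => ?_, hs.2⟩
        have := hs.1 t ht
        simp only [SegLE] at *
        omega
      · refine List.pairwise_cons.2 ⟨fun t ht => ?_, List.pairwise_cons.2 hs⟩
        rcases List.mem_cons.1 ht with rfl | ht
        · exact Or.inl (by simpa using h2)
        · have := hs.1 t ht
          simp only [SegLE] at *
          omega
      · refine List.pairwise_cons.2 ⟨fun t ht => ?_, ih hs.2⟩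
        rcases mem_ins ht with ht | rfl | ⟨d, hd, rfl⟩
        · exact hs.1 t ht
        · simp only [SegLE]
          omega
        · have := hs.1 _ hd
          simp only [SegLE] at *
          omega
  lt t ht := by
    rcases mem_ins ht with ht | rfl | ⟨d, hd, rfl⟩
    · exact h.lt t ht
    · simp only; omega
    · have := h.lt _ hd
      simp only at *
      omega

theorem IsNormal.cons_red {c : ℕ} (hc : c + 1 = n) {y : List (ℕ × ℕ)} (h : IsNormal n y) :
    IsNormal n ((c, 0) :: y) where
  sorted := by
    refine List.pairwise_cons.2 ⟨fun t ht => ?_, h.sorted⟩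
    have := h.lt t ht
    simp only [SegLE]
    omega
  lt t ht := by
    rcases List.mem_cons.1 ht with rfl | ht
    · simp only; omega
    · exact h.lt t ht

theorem exists_reach_word (l : List ℕ) (hl : ∀ x ∈ l, x < n) :
    ∃ y, IsNormal n y ∧ Reach v l (word y) := by
  induction l using List.reverseRecOn with
  | nil => exact ⟨[], ⟨List.Pairwise.nil, by simp⟩, Reach.refl _⟩
  | append_singleton l c ih =>
    obtain ⟨y, hy, hr⟩ := ih fun x hx => hl x (by simp [hx])
    have hc : c < n := hl c (by simp)
    by_cases h : c + 1 = n
    · exact ⟨(c, 0) :: y, hy.cons_red h, hr.append_right [c]⟩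
    · exact ⟨ins c y, hy.ins (by omega), (hr.append_right [c]).trans (reach_ins h y)⟩

/-- Every word can be brought into normal form by moves. -/
theorem exists_eqvGen_word (i : Seq v) :
    ∃ y j, IsNormal n y ∧ Relation.EqvGen Move i j ∧ toList j = word y := by
  obtain ⟨y, hy, hr⟩ := exists_reach_word (v := v) (toList i) (by simp [toList])
  obtain ⟨j, hj, hj'⟩ := hr [] [] i (by simp)
  exact ⟨y, j, hy, hj, by simpa using hj'⟩

/-! ### The word of a list of segments as a shuffle -/

/-- The letters of `word y`, each preceded by the index of the segment it comes from. -/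
def colouredWord : List (ℕ × ℕ) → List (ℕ × ℕ)
  | [] => []
  | s :: y => (colouredWord y).map (fun x => (x.1 + 1, x.2)) ++ (seg s.1 s.2).map (fun r => (0, r))

theorem map_snd_colouredWord (y : List (ℕ × ℕ)) : (colouredWord y).map Prod.snd = word y := by
  induction y with
  | nil => rfl
  | cons s y ih =>
    rw [colouredWord, word, List.map_append, List.map_map, List.map_map, ← ih]
    congr 1
    exact List.map_id _

theorem mem_colouredWord {y : List (ℕ × ℕ)} {q r : ℕ} :
    (q, r) ∈ colouredWord y ↔ Box y q r := by
  induction y generalizing q with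
  | nil => simp [colouredWord, Box]
  | cons s y ih =>
    rw [colouredWord, List.mem_append, List.mem_map, List.mem_map]
    cases q with
    | zero => simp [Box, mem_seg]
    | succ q =>
      rw [show Box (s :: y) (q + 1) r ↔ Box y q r by simp [Box], ← ih]
      simp

theorem colouredWord_pairwise (y : List (ℕ × ℕ)) :
    (colouredWord y).Pairwise fun x z => z.1 < x.1 ∨ (x.1 = z.1 ∧ z.2 < x.2) := by
  induction y with
  | nil => exact List.Pairwise.nil
  | cons s y ih =>
    rw [colouredWord, List.pairwise_append, List.pairwise_map, List.pairwise_map]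
    refine ⟨ih.imp fun h => by simpa using h, (seg_pairwise _ _).imp fun h => by simpa using h, ?_⟩
    simp only [List.mem_map]
    rintro _ ⟨x, -, rfl⟩ _ ⟨z, -, rfl⟩
    simp

theorem exists_isShuffle_word {y : List (ℕ × ℕ)} {i : Seq v} (h : toList i = word y) :
    ∃ c, IsShuffle y i c ∧ Antitone c := by
  have hlen : (colouredWord y).length = numStrands v := by
    rw [← length_toList i, h, ← map_snd_colouredWord, List.length_map]
  let W : Fin (numStrands v) → ℕ × ℕ :=
    fun p => (colouredWord y)[(p : ℕ)]'(by rw [hlen]; exact p.2)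
  have hW : ∀ p, (W p).2 = i.1 p := by
    intro p
    refine (letter_eq_of_getElem? h p ?_).symm
    rw [← map_snd_colouredWord, List.getElem?_map,
      List.getElem?_eq_getElem (by rw [hlen]; exact p.2)]
    rfl
  have hlt : ∀ p p', p < p' →
      (W p').1 < (W p).1 ∨ ((W p).1 = (W p').1 ∧ (W p').2 < (W p).2) := fun p p' hp =>
    List.pairwise_iff_getElem.1 (colouredWord_pairwise y) _ _ _ _ hp
  refine ⟨fun p => (W p).1, ⟨fun p => ?_, fun q r hq => ?_, fun p p' hp hc => ?_,
    fun p p' hp h1 h2 => ?_⟩, fun p p' hp => ?_⟩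
  · rw [← hW, ← mem_colouredWord]
    exact List.getElem_mem _
  · obtain ⟨p, hp, hp'⟩ := List.getElem_of_mem (mem_colouredWord.2 hq)
    refine ⟨⟨p, hlen ▸ hp⟩, congrArg Prod.fst hp', ?_⟩
    rw [← hW]
    exact congrArg Prod.snd hp'
  · have := hlt p p' hp
    rw [Fin.lt_def, ← hW, ← hW]
    omega
  · have := hlt p p' hp
    rw [hW, hW] at this
    simp only [IsRed] at h1 h2
    omega
  · rcases hp.eq_or_lt with rfl | hp
    · exact le_rfl
    · have := hlt p p' hp
      simp only
      omega

/-! ### A normal form is determined by the shuffles -/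

theorem IsNormal.top_le {y : List (ℕ × ℕ)} (hy : IsNormal n y) {q q' : ℕ} {s s' : ℕ × ℕ}
    (hs : y[q]? = some s) (hs' : y[q']? = some s') (h : q ≤ q') : s'.1 + s'.2 ≤ s.1 + s.2 := by
  rcases h.eq_or_lt with rfl | h
  · rw [hs, Option.some.injEq] at hs'
    rw [hs']
  · obtain ⟨h1, rfl⟩ := List.getElem?_eq_some_iff.1 hs
    obtain ⟨h2, rfl⟩ := List.getElem?_eq_some_iff.1 hs'
    have := List.pairwise_iff_getElem.1 hy.sorted _ _ h1 h2 h
    simp only [SegLE] at this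
    omega

/-- In a shuffle of a normal form, the colour of a red letter is the number of red letters behind
it. -/
theorem IsShuffle.eq_card {y : List (ℕ × ℕ)} (hy : IsNormal n y) {i : Seq v}
    {c : Fin (numStrands v) → ℕ} (h : IsShuffle y i c) {p : Fin (numStrands v)}
    (hp : IsRed (i.1 p)) :
    c p = (Finset.univ.filter fun p' => p < p' ∧ IsRed (i.1 p')).card := by
  rw [← Finset.card_range (c p)]
  symm
  refine Finset.card_nbij c (fun p' h1 => ?_) (fun p' h1 p'' h2 h3 => ?_) (fun q hq => ?_)
  · simp only [Finset.coe_filter, Finset.mem_univ, true_and, Set.mem_ofPred_eq, Finset.coe_range,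
      Set.mem_Iio] at h1 ⊢
    exact h.red p p' h1.1 hp h1.2
  · simp only [Finset.coe_filter, Finset.mem_univ, true_and, Set.mem_ofPred_eq] at h1 h2
    rcases lt_trichotomy p' p'' with h4 | h4 | h4
    · have := h.red _ _ h4 h1.2 h2.2
      omega
    · exact h4
    · have := h.red _ _ h4 h2.2 h1.2
      omega
  · simp only [Finset.coe_range, Set.mem_Iio] at hq
    obtain ⟨s, hs, h1, h2⟩ := h.box p
    have hqlt : q < y.length := hq.trans (List.getElem?_eq_some_iff.1 hs).1
    have hq' : y[q]? = some y[q] := List.getElem?_eq_getElem hqlt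
    have h3 := hy.top_le hq' hs hq.le
    have h4 := hy.lt _ (List.getElem_mem hqlt)
    simp only [IsRed] at hp
    obtain ⟨p', hp1, hp2⟩ := h.surj q (i.1 p) ⟨_, hq', by omega, by omega⟩
    have hp3 : IsRed (i.1 p') := by simp only [IsRed]; omega
    refine ⟨p', ?_, hp1⟩
    simp only [Finset.coe_filter, Finset.mem_univ, true_and, Set.mem_ofPred_eq]
    refine ⟨?_, hp3⟩
    rcases lt_trichotomy p p' with h5 | h5 | h5
    · exact h5
    · rw [← h5] at hp1
      omega
    · have := h.red _ _ h5 hp3 hp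
      omega

open Classical in
/-- The indices less than `T` of the segments of `y` that contain `[α, β]`. -/
def containing (y : List (ℕ × ℕ)) (α β T : ℕ) : Finset ℕ :=
  (Finset.range T).filter fun q => Box y q α ∧ Box y q β

theorem mem_containing {y : List (ℕ × ℕ)} {α β T q : ℕ} :
    q ∈ containing y α β T ↔ q < T ∧ Box y q α ∧ Box y q β := by
  simp [containing]

theorem Box.lt_length {y : List (ℕ × ℕ)} {q r : ℕ} (h : Box y q r) : q < y.length := by
  obtain ⟨s, hs, -⟩ := h
  exact (List.getElem?_eq_some_iff.1 hs).1

/-- If the word of the normal form `y` is a shuffle of the normal form `y'`, then at most as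
many segments of `y'` as of `y` contain `[α, β]`: in the word of `y`, the decreasing subword
`β, …, α` of a segment of `y'` ends in a segment of `y` that contains `[α, β]`, and different
subwords end in different segments.  If `β` is red, this can be refined by the order of the red
segments. -/
theorem card_containing_le {y y' : List (ℕ × ℕ)} (hy : IsNormal n y) (hy' : IsNormal n y')
    {i : Seq v} (hi : toList i = word y) (hs : ∃ c, IsShuffle y' i c) {α β T : ℕ} (hαβ : α ≤ β)
    (hT : β + 1 = n ∨ y.length ≤ T) :
    (containing y' α β T).card ≤ (containing y α β T).card := by
  obtain ⟨c, hc, hanti⟩ := exists_isShuffle_word hi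
  obtain ⟨c', hc'⟩ := hs
  refine Finset.card_le_card_of_forall_subsingleton
    (fun q' q => ∃ p, c' p = q' ∧ c p = q ∧ (i.1 p : ℕ) = α) (fun q' hq' => ?_)
    (fun q hq q₁ h1 q₂ h2 => ?_)
  · rw [mem_containing] at hq'
    obtain ⟨p₁, h1, h1'⟩ := hc'.surj _ _ hq'.2.2
    obtain ⟨p₂, h2, h2'⟩ := hc'.surj _ _ hq'.2.1
    have hle : p₁ ≤ p₂ := by
      by_contra hlt
      have := hc'.lt p₂ p₁ (not_le.1 hlt) (h2.trans h1.symm)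
      rw [Fin.lt_def] at this
      omega
    refine ⟨c p₂, ?_, p₂, h2, rfl, h2'⟩
    obtain ⟨s₁, e1, e2, e3⟩ := hc.box p₁
    obtain ⟨s₂, f1, f2, f3⟩ := hc.box p₂
    have htop := hy.top_le f1 e1 (hanti hle)
    rw [mem_containing]
    refine ⟨?_, ⟨s₂, f1, by omega, by omega⟩, ⟨s₂, f1, by omega, by omega⟩⟩
    rcases hT with hβ | hT
    · have hr : IsRed (i.1 p₁) := by simp only [IsRed]; omega
      have g1 := hc.eq_card hy hr
      have g2 := hc'.eq_card hy' hr
      have := hanti hle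
      omega
    · exact (hc.box p₂).lt_length.trans_le hT
  · obtain ⟨-, p₁, a1, a2, a3⟩ := h1
    obtain ⟨-, p₂, b1, b2, b3⟩ := h2
    have : p₁ = p₂ := by
      rcases lt_trichotomy p₁ p₂ with h | h | h
      · have := hc.lt _ _ h (a2.trans b2.symm)
        rw [Fin.lt_def] at this
        omega
      · exact h
      · have := hc.lt _ _ h (b2.trans a2.symm)
        rw [Fin.lt_def] at this
        omega
    rw [← a1, ← b1, this]

/-- The first segment in which two normal forms differ can be compared by counting segments. -/
theorem exists_getElem?_of_card_le {y y' : List (ℕ × ℕ)} (hy : IsNormal n y)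
    (hy' : IsNormal n y')
    (hcard : ∀ α β T, α ≤ β → (β + 1 = n ∨ y.length + y'.length ≤ T) →
      (containing y α β T).card ≤ (containing y' α β T).card)
    {q : ℕ} (heq : ∀ q' < q, y[q']? = y'[q']?) {s : ℕ × ℕ} (hs : y[q]? = some s) :
    ∃ s', y'[q]? = some s' ∧
      (s.1 + s.2 < s'.1 + s'.2 ∨ (s.1 + s.2 = s'.1 + s'.2 ∧ s'.1 ≤ s.1)) := by
  have hsn : s.1 + s.2 < n := hy.lt s (List.mem_of_getElem? hs)
  have hq : q < y.length := (List.getElem?_eq_some_iff.1 hs).1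
  -- For a red segment only those up to the `q`th are counted, for a black one all of them.
  obtain ⟨T, hqT, hT, hT'⟩ : ∃ T, q < T ∧ (s.1 + s.2 + 1 = n ∨ y.length + y'.length ≤ T) ∧
      (s.1 + s.2 + 1 = n → T = q + 1) := by
    by_cases hr : s.1 + s.2 + 1 = n
    · exact ⟨q + 1, by omega, Or.inl hr, fun _ => rfl⟩
    · exact ⟨y.length + y'.length, by omega, Or.inr le_rfl, fun h => absurd h hr⟩
  obtain ⟨q', hq', hle⟩ : ∃ q' ∈ containing y' s.1 (s.1 + s.2) T, q ≤ q' := by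
    by_contra hcon
    push Not at hcon
    have hsub : containing y' s.1 (s.1 + s.2) T ⊂ containing y s.1 (s.1 + s.2) T := by
      refine Finset.ssubset_iff_subset_ne.2 ⟨fun q' hq' => ?_, fun he => ?_⟩
      · have h1 := hcon q' hq'
        rw [mem_containing] at hq' ⊢
        simpa only [Box, heq q' h1] using hq'
      · have : q ∈ containing y s.1 (s.1 + s.2) T :=
          mem_containing.2 ⟨hqT, ⟨s, hs, by omega, by omega⟩, ⟨s, hs, by omega, by omega⟩⟩
        rw [← he] at this
        exact lt_irrefl _ (hcon q this)
    exact absurd (hcard s.1 (s.1 + s.2) T (by omega) hT) (Finset.card_lt_card hsub).not_ge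
  rw [mem_containing] at hq'
  obtain ⟨h1, ⟨t, ht, h2, -⟩, ⟨t', ht', -, h3⟩⟩ := hq'
  rw [ht, Option.some.injEq] at ht'
  subst ht'
  rcases hle.eq_or_lt with rfl | hlt
  · exact ⟨t, ht, by omega⟩
  · obtain ⟨hl, rfl⟩ := List.getElem?_eq_some_iff.1 ht
    refine ⟨y'[q], List.getElem?_eq_getElem (hlt.trans hl), ?_⟩
    have h4 := List.pairwise_iff_getElem.1 hy'.sorted _ _ (hlt.trans hl) hl hlt
    simp only [SegLE] at h4
    omega

theorem eq_of_isShuffle {y y' : List (ℕ × ℕ)} (hy : IsNormal n y) (hy' : IsNormal n y')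
    {i j : Seq v} (hi : toList i = word y) (hj : toList j = word y')
    (hs : ∃ c, IsShuffle y' i c) (hs' : ∃ c, IsShuffle y j c) : y = y' := by
  have h1 : ∀ α β T, α ≤ β → (β + 1 = n ∨ y'.length + y.length ≤ T) →
      (containing y' α β T).card ≤ (containing y α β T).card := fun α β T h hT =>
    card_containing_le hy hy' hi hs h (by omega)
  have h2 : ∀ α β T, α ≤ β → (β + 1 = n ∨ y.length + y'.length ≤ T) →
      (containing y α β T).card ≤ (containing y' α β T).card := fun α β T h hT =>
    card_containing_le hy' hy hj hs' h (by omega)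
  refine List.ext_getElem? fun q => ?_
  induction q using Nat.strong_induction_on with
  | _ q ih =>
    cases hs : y[q]? with
    | none =>
      cases hs' : y'[q]? with
      | none => rfl
      | some s' =>
        obtain ⟨s, h, -⟩ := exists_getElem?_of_card_le hy' hy h1 (fun q' h => (ih q' h).symm) hs'
        rw [hs] at h
        exact absurd h (by simp)
    | some s =>
      obtain ⟨s', h, h3⟩ := exists_getElem?_of_card_le hy hy' h2 ih hs
      obtain ⟨s'', h', h4⟩ := exists_getElem?_of_card_le hy' hy h1 (fun q' h => (ih q' h).symm) h
      rw [hs, Option.some.injEq] at h'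
      subst h'
      rw [h, Option.some.injEq, Prod.ext_iff]
      omega

theorem eqvGen_of_ev_mem {i j : Seq v} (hi : ev i ∈ NPrime j) (hj : ev j ∈ NPrime i) :
    Relation.EqvGen Move i j := by
  obtain ⟨y, i', hy, hii, hi'⟩ := exists_eqvGen_word i
  obtain ⟨y', j', hy', hjj, hj'⟩ := exists_eqvGen_word j
  have h : NPrime i' = NPrime j' := by
    rw [← NPrime_eq_of_eqvGen hii, ← NPrime_eq_of_eqvGen hjj]
    exact NPrime_eq_of_mem hi hj
  obtain ⟨c, hc, -⟩ := exists_isShuffle_word hi'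
  obtain ⟨c', hc', -⟩ := exists_isShuffle_word hj'
  have h1 := exists_isShuffle_of_ev_mem (h ▸ ev_mem_NPrime i') ⟨c', hc'⟩
  have h2 := exists_isShuffle_of_ev_mem (h.symm ▸ ev_mem_NPrime j') ⟨c, hc⟩
  obtain rfl := eq_of_isShuffle hy hy' hi' hj' h1 h2
  obtain rfl := toList_injective (hi'.trans hj'.symm)
  exact hii.trans _ _ _ (hjj.symm)

theorem nonempty_equiv_of_eq {i j : Seq v} (h : NPrime i = NPrime j) :
    Nonempty (N i ≃ₗ[Alg v] N j) := by
  unfold N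
  rw [h]
  exact ⟨LinearEquiv.refl _ _⟩

end
end KLRW

theorem mainTheorem2 {n : ℕ} (v : Fin n → ℕ) :
    (∀ i : KLRW.Seq v, ∃! M : Submodule (KLRW.Alg v) (KLRW.NPrime i), IsCoatom M) ∧
    ∀ i j : KLRW.Seq v,
      Nonempty (KLRW.N i ≃ₗ[KLRW.Alg v] KLRW.N j) ↔ Relation.EqvGen KLRW.Move i j := by
  refine ⟨KLRW.existsUnique_isCoatom, fun i j => ⟨fun ⟨θ⟩ => ?_, fun h => ?_⟩⟩
  · exact KLRW.eqvGen_of_ev_mem (KLRW.ev_mem_NPrime_of_equiv θ)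
      (KLRW.ev_mem_NPrime_of_equiv θ.symm)
  · exact KLRW.nonempty_equiv_of_eq (KLRW.NPrime_eq_of_eqvGen h)
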